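/- Let $\beta>0$ and let $A=\frac{\beta}{2}(-x_2\,dx_1+x_1\,dx_2)$ on $\mathbb R^2$. Let $\Omega\subset\mathbb R^2$ be a bounded simply connected domain whose boundary $\Gamma=\partial\Omega$ is a smooth simple closed curve; write $|\Omega|$ for its area and $|\Gamma|$ for the length of $\Gamma$. Let $\hat A$ be the restriction (pull-back) of $A$ to $\Gamma$, and let $\lambda_1(\Gamma,\hat A)$ be the first (smallest) eigenvalue of the magnetic Laplacian $\Delta_{\hat A}=-(\nabla_T-i\hat A(T))^2$ on $\Gamma$, where $T$ is a unit tangent field, i.e. the smallest $\lambda\in\mathbb R$ for which $\Delta_{\hat A}u=\lambda u$ for some smooth $u:\Gamma\to\mathbb C$, $u\not\equiv 0$. Then this smallest eigenvalue exists and $$\lambda_1(\Gamma,\hat A)=\frac{4\pi^2}{|\Gamma|^2}\min_{n\in\mathbb Z}\Big(n-\frac{\beta|\Omega|}{2\pi}\Big)^2 .$$ Moreover: 1. If $\Omega^*$ is a disk with $|\Omega^*|=|\Omega|$ and boundary $\Gamma^*$, then $\lambda_1(\Gamma,\hat A)\le\lambda_1(\Gamma^*,\hat A)$ (on the right, $\hat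 A$ is the restriction of $A$ to $\Gamma^*$). If $\frac{\beta|\Omega|}{2\pi}\notin\mathbb N$, then equality holds if and only if $\Omega$ is a disk (necessarily of the same radius as $\Omega^*$). 2. $\lambda_1(\Gamma,\hat A)\le\frac{\beta}{4}$, with equality if and only if $\Omega$ is a disk of radius $\frac{1}{\sqrt\beta}$. -/

import Mathlib

open Real MeasureTheory Set
open scoped ContDiff

/-- The Euclidean plane. -/
abbrev Plane : Type := EuclideanSpace ℝ (Fin 2)

/-- `γ` is a smooth regular parametrization, by the circle `ℝ / 2πℤ`, of the boundary of `Ω`: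
it exhibits `∂Ω` as a smooth simple closed curve (of either orientation). -/
structure IsBoundaryCurve (γ : ℝ → Plane) (Ω : Set Plane) : Prop where
  smooth : ContDiff ℝ ∞ γ
  periodic : Function.Periodic γ (2 * π)
  regular : ∀ t, deriv γ t ≠ 0
  simple : InjOn γ (Ico 0 (2 * π))
  range_eq : range γ = frontier Ω

/-- `Ω` is a bounded simply connected domain of the plane whose boundary is the smooth simple
closed curve parametrized by `γ`. -/
structure IsSmoothSimplyConnectedDomain (Ω : Set Plane) (γ : ℝ → Plane) : Prop where
  isOpen : IsOpen Ω
  bounded : Bornology.IsBounded Ω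
  simplyConnected : IsSimplyConnected Ω
  boundary : IsBoundaryCurve γ Ω

/-- The standard magnetic potential, the 1-form `(β / 2) (-x₂ dx₁ + x₁ dx₂)`, at the point `x`,
applied to the tangent vector `v`. -/
noncomputable def standardPotential (β : ℝ) (x v : Plane) : ℝ :=
  β / 2 * (-(x 1) * v 0 + x 0 * v 1)

/-- The length of the closed curve `γ`. -/
noncomputable def curveLength (γ : ℝ → Plane) : ℝ :=
  ∫ t in (0 : ℝ)..(2 * π), ‖deriv γ t‖

/-- The magnetic derivative `∇^Â_T u` of a function `u` on the curve along the unit tangent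
`T = γ' / |γ'|`, where `Â` is the pull-back of the standard potential to the curve. Functions
on the curve are written in the parameter `t`, so this is `(u' - i Â(γ') u) / |γ'|`. -/
noncomputable def magneticDeriv (β : ℝ) (γ : ℝ → Plane) (u : ℝ → ℂ) (t : ℝ) : ℂ :=
  (deriv u t - Complex.I * (standardPotential β (γ t) (deriv γ t) : ℂ) * u t) /
    (‖deriv γ t‖ : ℂ)

/-- The magnetic Laplacian `δ^Â d^Â = -(∇^Â_T)²` of the curve `γ`, with the metric induced from
the plane and the restricted potential `Â`. -/
noncomputable def curveMagneticLaplacian (β : ℝ) (γ : ℝ → Plane) (u : ℝ → ℂ) : ℝ → ℂ :=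
  fun t => -magneticDeriv β γ (magneticDeriv β γ u) t

/-- The eigenvalues of the magnetic Laplacian of the closed curve `γ`. Functions on the
closed curve are the `2π`-periodic functions of the parameter. -/
def curveEigenvalues (β : ℝ) (γ : ℝ → Plane) : Set ℝ :=
  {μ | ∃ u : ℝ → ℂ, ContDiff ℝ ∞ u ∧ Function.Periodic u (2 * π) ∧ u ≠ 0 ∧
    ∀ t, curveMagneticLaplacian β γ u t = (μ : ℂ) * u t}

/-- The first eigenvalue of the magnetic Laplacian of the closed curve `γ`. -/
noncomputable def curveLambda1 (β : ℝ) (γ : ℝ → Plane) : ℝ :=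
  sInf (curveEigenvalues β γ)

open Filter Topology ComplexConjugate

/-! Write `D` for the magnetic derivative, Φ for the circulation of the potential, `L` for the
length. An equation `-D² u = k² u` factors as `(D - ik)(D + ik)u = 0`, so each eigenfunction yields
a nonzero periodic solution of a first-order equation `D v = ±ik v`. Its solutions are multiples of
exp(i(∫A ± ks)), which close up exactly when Φ ± kL is in 2πℤ. Hence the spectrum is {((2πn -
Φ)/L)²} (`IsBoundaryCurve.curveEigenvalues_eq`). Green's formula gives |Φ| = β|Ω|
(`IsBoundaryCurve.abs_circulation`), and the sign is absorbed by n ↦ -n. With x = β|Ω|/2π and d =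
dist(x, ℤ), the first eigenvalue is 4π²d²/L².

A disk of equal area has the same d, so the comparison is the isoperimetric inequality 4π|Ω| ≤ L²,
and for d ≠ 0 equality forces equal lengths. For the universal bound, d ≤ 1/2 and d ≤ x give d² ≤
x/2, while L² ≥ 4π|Ω| = 8π²x/β; equality forces x = 1/2 and a disk.

Two classical facts carry the proof. Green's area formula (`IsRegularLoop.abs_integral_eq_area`) is
localized by a partition of unity: near a boundary point the domain is swept from the arc along a
transversal direction, where Fubini and the fundamental theorem of calculus suffice. This needs the
domain to lie on exactly one side of its boundary (`IsRegularLoop.exists_side`). The isoperimetric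
inequality with rigidity (`isoperimetric`) is Hurwitz's argument: constant speed, Wirtinger's
inequality, and ∫|w' - iw|² ≥ 0. -/

lemma Function.Periodic.deriv' {E : Type*} [NormedAddCommGroup E] [NormedSpace ℝ E] {f : ℝ → E}
    {T : ℝ} (hf : Function.Periodic f T) : Function.Periodic (deriv f) T := fun t => by
  rw [← deriv_comp_add_const]
  congr 1; ext1 s; exact hf s

/-! ### Plane vectors and regular loops. -/

/-- The determinant of two plane vectors. -/
def cross (a b : ℝ × ℝ) : ℝ := a.1 * b.2 - a.2 * b.1

/-- Rotation by a right angle. -/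
def rotate90 (a : ℝ × ℝ) : ℝ × ℝ := (-a.2, a.1)

/-- A `C¹` regular simple closed curve in `ℝ × ℝ`. -/
structure IsRegularLoop (c : ℝ → ℝ × ℝ) : Prop where
  contDiff : ContDiff ℝ 1 c
  periodic : Function.Periodic c (2 * π)
  regular : ∀ t, deriv c t ≠ 0
  injOn : InjOn c (Ico 0 (2 * π))

lemma cross_right_self (a : ℝ × ℝ) : cross a a = 0 := by simp only [cross]; ring

lemma cross_add_left (a b w : ℝ × ℝ) : cross (a + b) w = cross a w + cross b w := by
  simp only [cross, Prod.fst_add, Prod.snd_add]; ring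

lemma cross_sub_left (a b w : ℝ × ℝ) : cross (a - b) w = cross a w - cross b w := by
  simp only [cross, Prod.fst_sub, Prod.snd_sub]; ring

lemma cross_add_right (w a b : ℝ × ℝ) : cross w (a + b) = cross w a + cross w b := by
  simp only [cross, Prod.fst_add, Prod.snd_add]; ring

lemma cross_smul_left (s : ℝ) (a b : ℝ × ℝ) : cross (s • a) b = s * cross a b := by
  simp only [cross, Prod.smul_fst, Prod.smul_snd, smul_eq_mul]; ring

lemma cross_smul_right (s : ℝ) (a b : ℝ × ℝ) : cross a (s • b) = s * cross a b := by
  simp only [cross, Prod.smul_fst, Prod.smul_snd, smul_eq_mul]; ring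

lemma cross_rotate90_self_pos {a : ℝ × ℝ} (ha : a ≠ 0) : 0 < cross a (rotate90 a) := by
  have : 0 < a.1 ^ 2 + a.2 ^ 2 := by
    by_contra h
    have h1 : a.1 = 0 := by nlinarith [sq_nonneg a.1, sq_nonneg a.2]
    have h2 : a.2 = 0 := by nlinarith [sq_nonneg a.1, sq_nonneg a.2]
    exact ha (Prod.ext h1 h2)
  simp only [cross, rotate90]; nlinarith

@[fun_prop]
lemma Continuous.cross {X : Type*} [TopologicalSpace X] {f g : X → ℝ × ℝ} (hf : Continuous f)
    (hg : Continuous g) : Continuous fun x => cross (f x) (g x) := by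
  unfold _root_.cross; fun_prop

@[fun_prop]
lemma Continuous.rotate90 {X : Type*} [TopologicalSpace X] {f : X → ℝ × ℝ} (hf : Continuous f) :
    Continuous fun x => rotate90 (f x) := by
  unfold _root_.rotate90; fun_prop

lemma cross_cramer {v w : ℝ × ℝ} (h : cross v w ≠ 0) (a : ℝ × ℝ) :
    a = (cross a w / cross v w) • v + (cross v a / cross v w) • w := by
  have h1 : cross v w * a.1 = cross a w * v.1 + cross v a * w.1 := by
    simp only [cross]; ring
  have h2 : cross v w * a.2 = cross a w * v.2 + cross v a * w.2 := by
    simp only [cross]; ring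
  ext
  · simp only [Prod.fst_add, Prod.smul_fst, smul_eq_mul]; field_simp; linarith
  · simp only [Prod.snd_add, Prod.smul_snd, smul_eq_mul]; field_simp; linarith

lemma exists_eq_smul_of_cross_eq_zero {v a : ℝ × ℝ} (hv : v ≠ 0) (h : cross a v = 0) :
    ∃ s : ℝ, a = s • v := by
  have hv' : cross v (rotate90 v) ≠ 0 := (cross_rotate90_self_pos hv).ne'
  refine ⟨cross a (rotate90 v) / cross v (rotate90 v), ?_⟩
  have h0 : cross v a = 0 := by simp only [cross] at h ⊢; linarith
  have := cross_cramer hv' a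
  rwa [h0, zero_div, zero_smul, add_zero] at this

/-- The vectors lying strictly to the left of all the tangents of `c` over `I`. -/
def leftCone (c : ℝ → ℝ × ℝ) (I : Set ℝ) : Set (ℝ × ℝ) := {w | ∀ t ∈ I, 0 < cross (deriv c t) w}

lemma convex_leftCone (c : ℝ → ℝ × ℝ) (I : Set ℝ) : Convex ℝ (leftCone c I) := by
  intro x hx y hy a b ha hb hab t ht
  rw [cross_add_right, cross_smul_right, cross_smul_right]
  have h1 := hx t ht
  have h2 := hy t ht
  rcases ha.eq_or_lt with rfl | ha
  · have : b = 1 := by linarith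
    subst this; linarith
  · have := mul_pos ha h1
    have := mul_nonneg hb h2.le
    linarith

namespace IsRegularLoop

variable {c : ℝ → ℝ × ℝ} (hc : IsRegularLoop c)

include hc

lemma continuous : Continuous c := hc.contDiff.continuous

lemma hasDerivAt (t : ℝ) : HasDerivAt c (deriv c t) t :=
  (hc.contDiff.differentiable one_ne_zero t).hasDerivAt

lemma continuous_deriv : Continuous (deriv c) := hc.contDiff.continuous_deriv le_rfl

lemma add_int_mul (t : ℝ) (n : ℤ) : c (t + n * (2 * π)) = c t := hc.periodic.int_mul n t

/-- One period with the window around `t₀` removed has compact image, and by injectivity this image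
misses `c t₀`; so it stays at positive distance. -/
lemma exists_near (t₀ : ℝ) {η : ℝ} (hη : 0 < η) :
    ∃ r > 0, ∀ t, dist (c t) (c t₀) < r → ∃ n : ℤ, t + n * (2 * π) ∈ Ioo (t₀ - η) (t₀ + η) := by
  have hπ := Real.pi_pos
  set K : Set ℝ := Icc (t₀ - π) (t₀ + π) ∩ (Ioo (t₀ - η) (t₀ + η))ᶜ
  have hK : IsCompact K := isCompact_Icc.inter_right isOpen_Ioo.isClosed_compl
  have hKc : IsClosed (c '' K) := (hK.image hc.continuous).isClosed
  have hnot : c t₀ ∉ c '' K := by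
    rintro ⟨t, ⟨⟨h1, h2⟩, h3⟩, h4⟩
    have e : toIcoMod two_pi_pos 0 t = toIcoMod two_pi_pos 0 t₀ := by
      apply hc.injOn
      · simpa using toIcoMod_mem_Ico (two_pi_pos) 0 t
      · simpa using toIcoMod_mem_Ico (two_pi_pos) 0 t₀
      · simp only [toIcoMod, hc.periodic.sub_zsmul_eq]; exact h4
    simp only [toIcoMod, zsmul_eq_mul] at e
    set m := toIcoDiv two_pi_pos 0 t
    set k := toIcoDiv two_pi_pos 0 t₀
    have e' : t - t₀ = ((m - k : ℤ) : ℝ) * (2 * π) := by push_cast; linarith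
    have hlt : |((m - k : ℤ) : ℝ)| < 1 := by
      have : |t - t₀| ≤ π := abs_le.2 ⟨by linarith, by linarith⟩
      rw [e', abs_mul, abs_of_pos (two_pi_pos)] at this
      nlinarith
    have : m - k = 0 := by
      rw [← Int.abs_lt_one_iff]; exact_mod_cast hlt
    rw [this] at e'
    apply h3
    constructor <;> (simp at e'; linarith)
  obtain ⟨r, hr, hball⟩ := Metric.isOpen_iff.1 hKc.isOpen_compl _ hnot
  refine ⟨r, hr, fun t ht => ?_⟩
  have hmem := toIcoMod_mem_Ico two_pi_pos (t₀ - π) t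
  refine ⟨-toIcoDiv two_pi_pos (t₀ - π) t, ?_⟩
  have e : t + (-toIcoDiv two_pi_pos (t₀ - π) t : ℤ) * (2 * π) =
      toIcoMod two_pi_pos (t₀ - π) t := by
    simp only [toIcoMod, zsmul_eq_mul]; push_cast; ring
  by_contra hcon
  rw [e] at hcon
  refine hball (Metric.mem_ball.2 ht) ⟨toIcoMod two_pi_pos (t₀ - π) t, ⟨⟨hmem.1, ?_⟩, hcon⟩, ?_⟩
  · linarith [hmem.2]
  · rw [← e, hc.add_int_mul]

/-- Consequently the arc meets each line parallel to `w` at most once: it is a graph in the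
direction `w`. -/
lemma strictMonoOn_cross {a b : ℝ} {w : ℝ × ℝ} (hw : w ∈ leftCone c (Ioo a b)) :
    StrictMonoOn (fun t => cross (c t) w) (Ioo a b) := by
  have hd : ∀ t, HasDerivAt (fun t => cross (c t) w) (cross (deriv c t) w) t := fun t => by
    have h := hc.hasDerivAt t
    have h1 : HasDerivAt (fun t => (c t).1) (deriv c t).1 t := h.fst
    have h2 : HasDerivAt (fun t => (c t).2) (deriv c t).2 t := h.snd
    exact (h1.mul_const _).sub (h2.mul_const _)
  refine strictMonoOn_of_deriv_pos (convex_Ioo a b)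
    (fun t _ => (hd t).continuousAt.continuousWithinAt) fun t ht => ?_
  rw [(hd t).deriv]
  rw [interior_Ioo] at ht
  exact hw t ht

end IsRegularLoop

/-! ### Local charts and the two sides of the curve. -/

/-- Parameters of a neighbourhood of `c t₀` in which the curve `c` is a graph over its tangent. -/
structure IsLocalChart (c : ℝ → ℝ × ℝ) (t₀ η ε r : ℝ) : Prop where
  pos : 0 < ε
  le : ε ≤ η
  lt_pi : η < π
  r_pos : 0 < r
  far : ∀ t, dist (c t) (c t₀) < 2 * r → ∃ n : ℤ, t + n * (2 * π) ∈ Ioo (t₀ - η) (t₀ + η)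
  near : ∀ t ∈ Ioo (t₀ - ε) (t₀ + ε), dist (c t) (c t₀) < r / 2
  normal_mem : ∀ t ∈ Ioo (t₀ - η) (t₀ + η),
    rotate90 (deriv c t) ∈ leftCone c (Ioo (t₀ - η) (t₀ + η))
  oblique_mem : rotate90 (deriv c t₀) + deriv c t₀ ∈ leftCone c (Ioo (t₀ - η) (t₀ + η))

/-- The cone conditions are open and hold at `t₀`. The oblique vector is kept as a second
transversal direction, independent of the normal, so that the two span the plane. -/
lemma IsRegularLoop.exists_isLocalChart {c : ℝ → ℝ × ℝ} (hc : IsRegularLoop c) (t₀ : ℝ) :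
    ∃ η ε r, IsLocalChart c t₀ η ε r := by
  have hcd := hc.continuous_deriv
  have h1 : ∀ᶠ p : ℝ × ℝ in 𝓝 (t₀, t₀), 0 < cross (deriv c p.2) (rotate90 (deriv c p.1)) := by
    refine ContinuousAt.eventually_lt continuousAt_const (Continuous.continuousAt (by fun_prop)) ?_
    exact cross_rotate90_self_pos (hc.regular t₀)
  have h2 : ∀ᶠ t : ℝ in 𝓝 t₀, 0 < cross (deriv c t) (rotate90 (deriv c t₀) + deriv c t₀) := by
    refine ContinuousAt.eventually_lt continuousAt_const (Continuous.continuousAt (by fun_prop)) ?_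
    rw [cross_add_right, cross_right_self, add_zero]
    exact cross_rotate90_self_pos (hc.regular t₀)
  rw [Metric.eventually_nhds_iff] at h1 h2
  obtain ⟨η₁, hη₁, h1⟩ := h1
  obtain ⟨η₂, hη₂, h2⟩ := h2
  obtain ⟨η, hη, hlt⟩ : ∃ η > 0, η ≤ η₁ ∧ η ≤ η₂ ∧ η < π :=
    ⟨min (min η₁ η₂) 1, by positivity, (min_le_left _ _).trans (min_le_left _ _),
      (min_le_left _ _).trans (min_le_right _ _),
      (min_le_right _ _).trans_lt (by linarith [Real.pi_gt_three])⟩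
  obtain ⟨r, hr, hfar⟩ := hc.exists_near t₀ hη
  -- The radius of the chart will be `r / 2`, so `far` asks for distance `r` and `near` for `r / 4`.
  obtain ⟨ε, hε, hnear⟩ := Metric.continuousAt_iff.1 (hc.continuous.continuousAt (x := t₀)) (r / 4)
    (by positivity)
  have hd : ∀ {δ t : ℝ}, t ∈ Ioo (t₀ - δ) (t₀ + δ) → dist t t₀ < δ := fun h => by
    rw [Real.dist_eq, abs_lt]; constructor <;> linarith [h.1, h.2]
  refine ⟨η, min ε η, r / 2, ⟨by positivity, min_le_right _ _, hlt.2.2, by positivity, ?_, ?_, ?_, ?_⟩⟩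
  · intro t ht; exact hfar t (by linarith)
  · intro t ht
    have := hnear ((hd ht).trans_le (min_le_left _ _))
    linarith
  · intro t ht s hs
    refine h1 (y := (t, s)) ?_
    rw [Prod.dist_eq]
    exact max_lt ((hd ht).trans_le hlt.1) ((hd hs).trans_le hlt.1)
  · intro s hs
    exact h2 ((hd hs).trans_le hlt.2.1)

/-- Off the frontier, the space is the disjoint union of the open sets `interior S` and `(closure
S)ᶜ`. -/
lemma IsPreconnected.subset_or_disjoint_of_disjoint_frontier {X : Type*} [TopologicalSpace X]
    {Q S : Set X} (hQ : IsPreconnected Q) (h : Disjoint Q (frontier S)) : Q ⊆ S ∨ Disjoint Q S := by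
  rw [or_iff_not_imp_right, not_disjoint_iff]
  rintro ⟨x, hxQ, hxS⟩
  have hcov : Q ⊆ interior S ∪ (closure S)ᶜ := fun y hy => by
    by_contra hcon
    rw [mem_union, not_or, notMem_compl_iff] at hcon
    exact disjoint_left.1 h hy ⟨hcon.2, hcon.1⟩
  have hx : x ∈ interior S := by
    rcases hcov hxQ with h | h
    · exact h
    · exact absurd (subset_closure hxS) h
  refine (hQ.subset_left_of_subset_union isOpen_interior isClosed_closure.isOpen_compl ?_ hcov
    ⟨x, hxQ, hx⟩).trans interior_subset
  exact disjoint_left.2 fun y hy hy' => hy' (interior_subset_closure hy)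

/-- The points obtained by moving from the arc `c` of `Ioo a b` to the left (`σ = 1`) or to the
right (`σ = -1`) by a vector shorter than `r`, uniformly transversal to the arc over `I`. -/
def sideRegion (c : ℝ → ℝ × ℝ) (I J : Set ℝ) (r σ : ℝ) : Set (ℝ × ℝ) :=
  (fun p : ℝ × (ℝ × ℝ) => c p.1 + σ • p.2) '' (J ×ˢ (leftCone c I ∩ Metric.ball 0 r))

lemma isPreconnected_sideRegion {c : ℝ → ℝ × ℝ} (hc : Continuous c) (I : Set ℝ) (a b r σ : ℝ) :
    IsPreconnected (sideRegion c I (Ioo a b) r σ) := by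
  refine IsPreconnected.image ?_ _ (by fun_prop)
  exact ((convex_Ioo _ _).prod ((convex_leftCone _ _).inter (convex_ball _ _))).isPreconnected

lemma mem_sideRegion_of_eq {c : ℝ → ℝ × ℝ} {I J : Set ℝ} {r : ℝ} {v : ℝ × ℝ} (hv : v ∈ leftCone c I)
    {t s σ : ℝ} (ht : t ∈ J) (hs : 0 < s) (hsv : ‖s • v‖ < r) :
    c t + (σ * s) • v ∈ sideRegion c I J r σ := by
  refine ⟨(t, s • v), ⟨ht, fun u hu => ?_, by simpa using hsv⟩, by simp [mul_smul]⟩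
  rw [cross_smul_right]
  exact mul_pos hs (hv u hu)

namespace IsLocalChart

variable {c : ℝ → ℝ × ℝ} {t₀ η ε r : ℝ} (h : IsLocalChart c t₀ η ε r) (hc : IsRegularLoop c)

include h

lemma subset : Ioo (t₀ - ε) (t₀ + ε) ⊆ Ioo (t₀ - η) (t₀ + η) :=
  Ioo_subset_Ioo (by linarith [h.le]) (by linarith [h.le])

lemma mem_Ioo : t₀ ∈ Ioo (t₀ - ε) (t₀ + ε) := ⟨by linarith [h.pos], by linarith [h.pos]⟩

include hc

/-- If `c t + σ • w` were a curve point `c t'`, then `t'` would lie in the chart up to a period.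
Moving along `w` preserves `cross · w`, which is injective on the chart, so `t' = t` and `w = 0`,
which is not in the cone. -/
lemma disjoint_sideRegion {σ : ℝ} (hσ : |σ| = 1) :
    Disjoint (sideRegion c (Ioo (t₀ - η) (t₀ + η)) (Ioo (t₀ - ε) (t₀ + ε)) r σ) (range c) := by
  rw [disjoint_left]
  rintro _ ⟨⟨t, w⟩, ⟨ht, hw, hwr⟩, rfl⟩ ⟨t', ht'⟩
  simp only at ht hw hwr ht'
  have hdist : dist (c t') (c t₀) < 2 * r := by
    rw [ht']
    have h1 : dist (c t + σ • w) (c t) < r := by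
      rw [dist_eq_norm, add_sub_cancel_left, norm_smul, Real.norm_eq_abs, hσ, one_mul]
      simpa using hwr
    have h2 := h.near t ht
    have h3 := h.r_pos
    linarith [dist_triangle (c t + σ • w) (c t) (c t₀)]
  obtain ⟨n, hn⟩ := h.far t' hdist
  rw [← hc.add_int_mul t' n] at ht'
  have hcr : cross (c (t' + n * (2 * π))) w = cross (c t) w := by
    rw [ht', cross_add_left, cross_smul_left, cross_right_self, mul_zero, add_zero]
  have htt := (hc.strictMonoOn_cross hw).injOn hn (h.subset ht) hcr
  rw [htt, left_eq_add] at ht'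
  have hw0 : w = 0 := by
    rcases smul_eq_zero.1 ht' with h0 | h0
    · rw [h0] at hσ; simp at hσ
    · exact h0
  have := hw t (h.subset ht)
  simp [hw0, cross] at this

lemma subset_or_disjoint {S : Set (ℝ × ℝ)} (hS : frontier S = range c) {σ : ℝ} (hσ : |σ| = 1) :
    sideRegion c (Ioo (t₀ - η) (t₀ + η)) (Ioo (t₀ - ε) (t₀ + ε)) r σ ⊆ S ∨
    Disjoint (sideRegion c (Ioo (t₀ - η) (t₀ + η)) (Ioo (t₀ - ε) (t₀ + ε)) r σ) S :=
  (isPreconnected_sideRegion hc.continuous _ _ _ _ σ).subset_or_disjoint_of_disjoint_frontier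
    (hS ▸ h.disjoint_sideRegion hc hσ)

/-- The intermediate value theorem for `cross (c t) v`: the line through `p` parallel to `v` must
cross the arc. -/
lemma eventually_exists_eq {v : ℝ × ℝ} (hv : v ∈ leftCone c (Ioo (t₀ - η) (t₀ + η))) :
    ∀ᶠ p in 𝓝 (c t₀), ∃ t ∈ Ioo (t₀ - ε) (t₀ + ε), ∃ s : ℝ, p = c t + s • v := by
  have hε := h.pos
  have hm := hc.strictMonoOn_cross hv
  have ha : t₀ - ε / 2 ∈ Ioo (t₀ - ε) (t₀ + ε) := ⟨by linarith, by linarith⟩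
  have hb : t₀ + ε / 2 ∈ Ioo (t₀ - ε) (t₀ + ε) := ⟨by linarith, by linarith⟩
  have h0 := h.mem_Ioo
  have h1 : ∀ᶠ p in 𝓝 (c t₀), cross (c (t₀ - ε / 2)) v < cross p v :=
    ContinuousAt.eventually_lt continuousAt_const (Continuous.continuousAt (by fun_prop))
      (hm (h.subset ha) (h.subset h0) (by linarith))
  have h2 : ∀ᶠ p in 𝓝 (c t₀), cross p v < cross (c (t₀ + ε / 2)) v :=
    ContinuousAt.eventually_lt (Continuous.continuousAt (by fun_prop)) continuousAt_const
      (hm (h.subset h0) (h.subset hb) (by linarith))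
  have hcont := hc.continuous
  filter_upwards [h1, h2] with p hp1 hp2
  obtain ⟨t, ht, htp⟩ := intermediate_value_Icc (f := fun t => cross (c t) v)
    (show t₀ - ε / 2 ≤ t₀ + ε / 2 by linarith) (Continuous.continuousOn (by fun_prop))
    ⟨hp1.le, hp2.le⟩
  refine ⟨t, ⟨by linarith [ht.1], by linarith [ht.2]⟩, ?_⟩
  have hv0 : v ≠ 0 := by
    rintro rfl
    have := hv t₀ (h.subset h0)
    simp [cross] at this
  obtain ⟨s, hs⟩ := exists_eq_smul_of_cross_eq_zero hv0 (a := p - c t) (by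
    rw [cross_sub_left]; simp only at htp; linarith)
  exact ⟨s, by rw [← hs]; abel⟩

lemma eventually_mem_sides :
    ∀ᶠ p in 𝓝 (c t₀), p ∈ range c ∨
      p ∈ sideRegion c (Ioo (t₀ - η) (t₀ + η)) (Ioo (t₀ - ε) (t₀ + ε)) r 1 ∨
      p ∈ sideRegion c (Ioo (t₀ - η) (t₀ + η)) (Ioo (t₀ - ε) (t₀ + ε)) r (-1) := by
  have hv := h.normal_mem t₀ (h.subset h.mem_Ioo)
  have hr := h.r_pos
  filter_upwards [h.eventually_exists_eq hc hv, Metric.ball_mem_nhds (c t₀) (half_pos hr)]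
    with p ⟨t, ht, s, hp⟩ hpr
  have hsr : ‖s • rotate90 (deriv c t₀)‖ < r := by
    have h1 : dist p (c t) < r := by
      have := h.near t ht
      rw [Metric.mem_ball] at hpr
      linarith [dist_triangle_right p (c t) (c t₀)]
    rwa [hp, dist_eq_norm, add_sub_cancel_left] at h1
  rcases lt_trichotomy s 0 with hs | hs | hs
  · right; right
    have := mem_sideRegion_of_eq hv (s := -s) (σ := -1) ht (by linarith)
      (by rwa [neg_smul, norm_neg])
    rwa [neg_one_mul, neg_neg, ← hp] at this
  · left; exact ⟨t, by simp [hp, hs]⟩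
  · right; left
    have := mem_sideRegion_of_eq hv (s := s) (σ := 1) ht hs hsr
    rwa [one_mul, ← hp] at this

/-- Whether the side `σ` of the curve at `t` belongs to `S` does not depend on `t` near `t₀`. -/
lemma eventually_mem_iff {S : Set (ℝ × ℝ)} (hS : frontier S = range c) {σ : ℝ} (hσ : |σ| = 1)
    {t : ℝ} (ht : t ∈ Ioo (t₀ - ε) (t₀ + ε)) :
    (∀ᶠ s in 𝓝[>] (0 : ℝ), c t + (σ * s) • rotate90 (deriv c t) ∈ S) ↔
      sideRegion c (Ioo (t₀ - η) (t₀ + η)) (Ioo (t₀ - ε) (t₀ + ε)) r σ ⊆ S := by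
  have hev : ∀ᶠ s in 𝓝[>] (0 : ℝ), c t + (σ * s) • rotate90 (deriv c t) ∈
      sideRegion c (Ioo (t₀ - η) (t₀ + η)) (Ioo (t₀ - ε) (t₀ + ε)) r σ := by
    have hlim : ∀ᶠ s in 𝓝 (0 : ℝ), ‖s • rotate90 (deriv c t)‖ < r :=
      ContinuousAt.eventually_lt (Continuous.continuousAt (by fun_prop)) continuousAt_const
        (by simpa using h.r_pos)
    filter_upwards [self_mem_nhdsWithin, nhdsWithin_le_nhds hlim] with s hs hsr
    exact mem_sideRegion_of_eq (h.normal_mem t (h.subset ht)) ht hs hsr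
  constructor
  · intro hin
    refine (h.subset_or_disjoint hc hS hσ).resolve_right fun hdis => ?_
    obtain ⟨s, hs1, hs2⟩ := (hin.and hev).exists
    exact disjoint_left.1 hdis hs2 hs1
  · intro hsub
    exact hev.mono fun s hs => hsub hs

end IsLocalChart

/-- The points of the side `σ` (left for `1`, right for `-1`) of `c` near `c t` belong to `S`. -/
def IsSide (c : ℝ → ℝ × ℝ) (S : Set (ℝ × ℝ)) (σ t : ℝ) : Prop :=
  ∀ᶠ s in 𝓝[>] (0 : ℝ), c t + (σ * s) • rotate90 (deriv c t) ∈ S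

/-- In a chart, the condition at every nearby `t` is equivalent to inclusion of one fixed side
region, so it is locally constant in `t`, hence constant on the connected line. -/
lemma IsRegularLoop.isSide_const {c : ℝ → ℝ × ℝ} (hc : IsRegularLoop c) {S : Set (ℝ × ℝ)}
    (hS : frontier S = range c) {σ : ℝ} (hσ : |σ| = 1) (t t' : ℝ) (h : IsSide c S σ t) :
    IsSide c S σ t' := by
  have key : ∀ t₀, ∀ᶠ t in 𝓝 t₀, (IsSide c S σ t ↔ IsSide c S σ t₀) := fun t₀ => by
    obtain ⟨η, ε, r, hl⟩ := hc.exists_isLocalChart t₀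
    filter_upwards [Ioo_mem_nhds hl.mem_Ioo.1 hl.mem_Ioo.2] with t ht
    exact (hl.eventually_mem_iff hc hS hσ ht).trans
      (hl.eventually_mem_iff hc hS hσ hl.mem_Ioo).symm
  have hclopen : IsClopen {t | IsSide c S σ t} := by
    constructor
    · rw [← isOpen_compl_iff, isOpen_iff_mem_nhds]
      intro t₀ ht₀
      filter_upwards [key t₀] with t ht
      exact fun h' => ht₀ (ht.1 h')
    · rw [isOpen_iff_mem_nhds]
      intro t₀ ht₀
      filter_upwards [key t₀] with t ht
      exact ht.2 ht₀
  have := hclopen.eq_univ ⟨t, h⟩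
  exact this.ge (mem_univ t')

/-- A bounded open set bounded by a simple closed curve lies on exactly one side of the curve. -/
lemma IsRegularLoop.exists_side {c : ℝ → ℝ × ℝ} (hc : IsRegularLoop c) {S : Set (ℝ × ℝ)}
    (hSo : IsOpen S) (hSb : Bornology.IsBounded S) (hS : frontier S = range c) :
    ((∀ t, IsSide c S 1 t) ∧ ∀ t, ¬ IsSide c S (-1) t) ∨
      ((∀ t, IsSide c S (-1) t) ∧ ∀ t, ¬ IsSide c S 1 t) := by
  have h1 : |(1 : ℝ)| = 1 := by simp
  have h2 : |(-1 : ℝ)| = 1 := by simp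
  by_cases ha : IsSide c S 1 0 <;> by_cases hb : IsSide c S (-1) 0
  -- If both sides belong to `S`, then `closure S` is open as well as closed, hence the whole plane,
  -- contradicting boundedness.
  · exfalso
    have hopen : IsOpen (S ∪ range c) := by
      rw [isOpen_iff_mem_nhds]
      rintro p (hp | ⟨t₀, rfl⟩)
      · exact mem_of_superset (hSo.mem_nhds hp) subset_union_left
      · obtain ⟨η, ε, r, hl⟩ := hc.exists_isLocalChart t₀
        have e1 := (hl.eventually_mem_iff hc hS h1 hl.mem_Ioo).1 (hc.isSide_const hS h1 _ _ ha)
        have e2 := (hl.eventually_mem_iff hc hS h2 hl.mem_Ioo).1 (hc.isSide_const hS h2 _ _ hb)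
        filter_upwards [hl.eventually_mem_sides hc] with p hp
        rcases hp with hp | hp | hp
        · exact Or.inr hp
        · exact Or.inl (e1 hp)
        · exact Or.inl (e2 hp)
    have hclosed : IsClosed (S ∪ range c) := by
      rw [← hS, ← closure_eq_self_union_frontier]; exact isClosed_closure
    have huniv := IsClopen.eq_univ ⟨hclosed, hopen⟩ ⟨c 0, Or.inr ⟨0, rfl⟩⟩
    have hbd : Bornology.IsBounded (S ∪ range c) := by
      rw [← hS, ← closure_eq_self_union_frontier]; exact hSb.closure
    rw [huniv] at hbd
    exact NormedSpace.unbounded_univ ℝ (ℝ × ℝ) hbd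
  · exact Or.inl ⟨fun t => hc.isSide_const hS h1 _ _ ha,
      fun t h => hb (hc.isSide_const hS h2 _ _ h)⟩
  · exact Or.inr ⟨fun t => hc.isSide_const hS h2 _ _ hb,
      fun t h => ha (hc.isSide_const hS h1 _ _ h)⟩
  -- If neither side belongs to `S`, every point near `c 0` is on the curve or outside `S`, although
  -- `c 0` lies in the closure of `S`.
  · exfalso
    obtain ⟨η, ε, r, hl⟩ := hc.exists_isLocalChart 0
    have e1 := (hl.subset_or_disjoint hc hS h1).resolve_left
      fun h => ha ((hl.eventually_mem_iff hc hS h1 hl.mem_Ioo).2 h)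
    have e2 := (hl.subset_or_disjoint hc hS h2).resolve_left
      fun h => hb ((hl.eventually_mem_iff hc hS h2 hl.mem_Ioo).2 h)
    have hmem : c 0 ∈ closure S := frontier_subset_closure (hS ▸ mem_range_self 0)
    rw [mem_closure_iff_frequently] at hmem
    obtain ⟨p, hpS, hp⟩ := (hmem.and_eventually (hl.eventually_mem_sides hc)).exists
    rcases hp with hp | hp | hp
    · rw [← hS, hSo.frontier_eq] at hp
      exact hp.2 hpS
    · exact disjoint_left.1 e1 hp hpS
    · exact disjoint_left.1 e2 hp hpS

lemma IsRegularLoop.reverse {c : ℝ → ℝ × ℝ} (hc : IsRegularLoop c) :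
    IsRegularLoop fun t => c (-t) where
  contDiff := hc.contDiff.comp contDiff_neg
  periodic t := by
    have := hc.periodic (-(t + 2 * π))
    simp only at this ⊢
    rw [← this]; congr 1; ring
  regular t := by
    rw [deriv_comp_neg]; exact neg_ne_zero.2 (hc.regular _)
  injOn := by
    have hper := hc.periodic
    intro s hs t ht hst
    -- Negation does not preserve the half-open period: `0` is fixed, and every other parameter is
    -- moved back by `2 * π`.
    have key : ∀ s ∈ Ico 0 (2 * π), ∃ s' ∈ Ico 0 (2 * π), c s' = c (-s) ∧
        (s = 0 ∧ s' = 0 ∨ s ≠ 0 ∧ s' = 2 * π - s) := fun s hs => by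
      rcases eq_or_ne s 0 with rfl | h0
      · exact ⟨0, hs, by simp, Or.inl ⟨rfl, rfl⟩⟩
      · have hpos : 0 < s := lt_of_le_of_ne hs.1 h0.symm
        refine ⟨2 * π - s, ⟨by linarith [hs.2], by linarith⟩, ?_, Or.inr ⟨h0, rfl⟩⟩
        rw [← hper (-s)]; congr 1; ring
    obtain ⟨s', hs', e1, h1⟩ := key s hs
    obtain ⟨t', ht', e2, h2⟩ := key t ht
    have := hc.injOn hs' ht' (e1.trans (hst.trans e2.symm))
    rcases h1 with ⟨h1, h1'⟩ | ⟨h1, h1'⟩ <;> rcases h2 with ⟨h2, h2'⟩ | ⟨h2, h2'⟩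
    · linarith
    · linarith [hs.2, ht.2]
    · linarith [hs.2, ht.2]
    · linarith

lemma isSide_reverse_iff {c : ℝ → ℝ × ℝ} {S : Set (ℝ × ℝ)} {σ t : ℝ} :
    IsSide (fun t => c (-t)) S σ t ↔ IsSide c S (-σ) (-t) := by
  have e : ∀ s : ℝ, (σ * s) • rotate90 (deriv (fun t => c (-t)) t) =
      (-σ * s) • rotate90 (deriv c (-t)) := fun s => by
    rw [deriv_comp_neg]
    ext <;> simp [rotate90]
  simp only [IsSide, e]

/-! ### Green's formula and the enclosed area. -/

/-- The divergence formula for constant vector fields `v` multiplied by the function `f`. -/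
def HasGreenFormula (c : ℝ → ℝ × ℝ) (S : Set (ℝ × ℝ)) (f : ℝ × ℝ → ℝ) (v : ℝ × ℝ) : Prop :=
  ∫ p in S, fderiv ℝ f p v = -∫ t in (0 : ℝ)..(2 * π), f (c t) * cross (deriv c t) v

lemma det_smulRight_add_smulRight (a b : ℝ × ℝ) :
    ((ContinuousLinearMap.fst ℝ ℝ ℝ).smulRight a +
      (ContinuousLinearMap.snd ℝ ℝ ℝ).smulRight b).det = cross a b := by
  rw [ContinuousLinearMap.det, ← LinearMap.det_toMatrix (Module.Basis.finTwoProd ℝ),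
    Matrix.det_fin_two]
  simp [LinearMap.toMatrix_apply, cross]
  ring

/-- The map `(t, s) ↦ c t + s • v` straightens the domain, with Jacobian `cross (deriv c t) v > 0`;
Fubini and integration in `s` leave only the value of `f` on the arc. Since `v` is constant, this
map is `C¹` although the curve is only `C¹`. -/
lemma IsLocalChart.exists_hasGreenFormula {c : ℝ → ℝ × ℝ} {t₀ η ε r : ℝ}
    (h : IsLocalChart c t₀ η ε r) (hc : IsRegularLoop c) {S : Set (ℝ × ℝ)}
    (hSo : IsOpen S) (hS : frontier S = range c) (hl : IsSide c S 1 t₀)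
    (hr : ¬ IsSide c S (-1) t₀) {v : ℝ × ℝ} (hv : v ∈ leftCone c (Ioo (t₀ - η) (t₀ + η))) :
    ∀ᶠ U in (𝓝 (c t₀)).smallSets, ∀ f : ℝ × ℝ → ℝ, ContDiff ℝ 1 f → tsupport f ⊆ U →
      HasGreenFormula c S f v := by
  have h1 : |(1 : ℝ)| = 1 := by simp
  have h2 : |(-1 : ℝ)| = 1 := by simp
  have hcc := hc.continuous
  have hcd := hc.continuous_deriv
  have hrpos := h.r_pos
  have hεpos := h.pos
  have hεπ : ε < π := h.le.trans_lt h.lt_pi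
  obtain ⟨δ, hδ, hnear⟩ := hc.exists_near t₀ h.pos
  have hleft := (h.eventually_mem_iff hc hS h1 h.mem_Ioo).1 hl
  have hright := (h.subset_or_disjoint hc hS h2).resolve_left
      fun h' => hr ((h.eventually_mem_iff hc hS h2 h.mem_Ioo).2 h')
  have hv0 : v ≠ 0 := by
    rintro rfl
    have := hv t₀ (h.subset h.mem_Ioo)
    simp [cross] at this
  have hvn : 0 < ‖v‖ := norm_pos_iff.2 hv0
  rw [eventually_smallSets]
  refine ⟨_, inter_mem (h.eventually_exists_eq hc hv) (inter_mem
    (Metric.ball_mem_nhds (c t₀) (half_pos hrpos)) (Metric.ball_mem_nhds (c t₀) hδ)), ?_⟩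
  intro U hU f hf hfU
  have hU' := hfU.trans hU
  set I := Ioo (t₀ - ε) (t₀ + ε)
  set ρ := r / ‖v‖ with hρ
  have hρpos : 0 < ρ := by positivity
  set B : Set (ℝ × ℝ) := I ×ˢ Ioo 0 ρ
  set Ψ : ℝ × ℝ → ℝ × ℝ := fun p => c p.1 + p.2 • v with hΨ
  have hnorm : ∀ s : ℝ, |s| < ρ ↔ ‖s • v‖ < r := fun s => by
    rw [norm_smul, Real.norm_eq_abs, hρ, lt_div_iff₀ hvn]
  have hf0 : ∀ p, p ∉ tsupport f → fderiv ℝ f p = 0 := fun p hp => by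
    have := mt (fun h => support_fderiv_subset ℝ (f := f) h) hp
    simpa using this
  -- localization of the left-hand side
  have hBS : Ψ '' B ⊆ S := by
    rintro _ ⟨⟨t, s⟩, ⟨ht, hs⟩, rfl⟩
    have := mem_sideRegion_of_eq (σ := 1) hv ht hs.1
      ((hnorm s).1 (by rw [abs_of_pos hs.1]; exact hs.2))
    rw [one_mul] at this
    exact hleft this
  -- A point `c t + s • v` of the support with `s < 0` lies on the excluded side, and with `s = 0`
  -- on the frontier; only `s > 0` meets `S`.
  have hzero : ∀ p ∈ S \ Ψ '' B, fderiv ℝ f p v = 0 := by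
    rintro p ⟨hpS, hpB⟩
    by_cases hp : p ∈ tsupport f
    swap
    · rw [hf0 p hp]; simp
    exfalso
    obtain ⟨⟨t, ht, s, hps⟩, hpr, -⟩ := hU' hp
    have hsr : ‖s • v‖ < r := by
      have h1 : dist p (c t) < r := by
        have := h.near t ht
        rw [Metric.mem_ball] at hpr
        linarith [dist_triangle_right p (c t) (c t₀)]
      rwa [hps, dist_eq_norm, add_sub_cancel_left] at h1
    rcases lt_trichotomy s 0 with hs | hs | hs
    · have := mem_sideRegion_of_eq (σ := -1) (s := -s) hv ht (by linarith)
        (by rwa [neg_smul, norm_neg])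
      rw [neg_one_mul, neg_neg, ← hps] at this
      exact disjoint_left.1 hright this hpS
    · have : p ∈ frontier S := by rw [hS]; exact ⟨t, by simp [hps, hs]⟩
      rw [hSo.frontier_eq] at this
      exact this.2 hpS
    · refine hpB ⟨(t, s), ⟨ht, hs, ?_⟩, hps.symm⟩
      have := (hnorm s).2 hsr
      rwa [abs_of_pos hs] at this
  have hcB : MeasurableSet B := measurableSet_Ioo.prod measurableSet_Ioo
  have hderiv : ∀ p ∈ B, HasFDerivWithinAt Ψ ((ContinuousLinearMap.fst ℝ ℝ ℝ).smulRight
      (deriv c p.1) + (ContinuousLinearMap.snd ℝ ℝ ℝ).smulRight v) B p := fun p _ => by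
    apply HasFDerivAt.hasFDerivWithinAt
    apply HasFDerivAt.add
    · exact ((hc.hasDerivAt p.1).hasFDerivAt.comp p hasFDerivAt_fst).congr_fderiv (by ext <;> simp)
    · exact hasFDerivAt_snd.smul_const v
  have hinj : InjOn Ψ B := by
    rintro ⟨t, s⟩ ⟨ht, -⟩ ⟨t', s'⟩ ⟨ht', -⟩ he
    simp only [hΨ] at he
    have htt : t = t' := by
      apply (hc.strictMonoOn_cross hv).injOn (h.subset ht) (h.subset ht')
      have := congrArg (fun x => cross x v) he
      simpa only [cross_add_left, cross_smul_left, cross_right_self, mul_zero, add_zero] using this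
    subst htt
    rw [add_right_inj, smul_left_inj hv0] at he
    rw [he]
  have hdf : Continuous fun p => fderiv ℝ f p v :=
    (hf.continuous_fderiv one_ne_zero).clm_apply continuous_const
  have hcontF : Continuous fun p : ℝ × ℝ => |cross (deriv c p.1) v| * fderiv ℝ f (Ψ p) v := by
    have : Continuous Ψ := by fun_prop
    fun_prop
  have hint : IntegrableOn (fun p : ℝ × ℝ => |cross (deriv c p.1) v| * fderiv ℝ f (Ψ p) v) B := by
    refine (hcontF.integrableOn_Icc (a := (t₀ - ε, 0)) (b := (t₀ + ε, ρ))).mono_set ?_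
    rw [← Icc_prod_Icc]
    exact prod_mono Ioo_subset_Icc_self Ioo_subset_Icc_self
  have hpt : ∀ t ∈ I, ∫ s in Ioo 0 ρ, |cross (deriv c t) v| * fderiv ℝ f (Ψ (t, s)) v =
      -(f (c t) * cross (deriv c t) v) := fun t ht => by
    rw [abs_of_pos (hv t (h.subset ht)), integral_const_mul, ← integral_Ioc_eq_integral_Ioo,
      ← intervalIntegral.integral_of_le hρpos.le,
      intervalIntegral.integral_eq_sub_of_hasDerivAt (f := fun s => f (Ψ (t, s)))]
    · have hend : f (Ψ (t, ρ)) = 0 := by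
        apply image_eq_zero_of_notMem_tsupport
        intro hmem
        have h3 := (hU' hmem).2.1
        rw [Metric.mem_ball] at h3
        have h4 := h.near t ht
        have h5 : dist (Ψ (t, ρ)) (c t) = r := by
          rw [hΨ, dist_eq_norm, add_sub_cancel_left, norm_smul, Real.norm_eq_abs,
            abs_of_pos hρpos, hρ]
          field_simp
        linarith [dist_triangle_right (Ψ (t, ρ)) (c t) (c t₀)]
      rw [hend]
      simp only [hΨ, zero_smul, add_zero]; ring
    · intro s _
      have hd1 : HasDerivAt (fun s => Ψ (t, s)) v s := by
        have := ((hasDerivAt_id s).smul_const v).const_add (c t)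
        rwa [one_smul] at this
      exact ((hf.differentiable one_ne_zero (Ψ (t, s))).hasFDerivAt.comp_hasDerivAt s hd1)
    · apply Continuous.intervalIntegrable
      have : Continuous Ψ := by fun_prop
      fun_prop
  have hper : Function.Periodic (fun t => f (c t) * cross (deriv c t) v) (2 * π) := fun t => by
    have hd := hc.periodic.deriv' t
    simp only [hc.periodic t, hd]
  rw [HasGreenFormula, setIntegral_eq_of_subset_of_forall_sdiff_eq_zero hSo.measurableSet hBS hzero,
    integral_image_eq_integral_abs_det_fderiv_smul volume hcB hderiv hinj]
  simp only [det_smulRight_add_smulRight, smul_eq_mul]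
  rw [Measure.volume_eq_prod, setIntegral_prod _ (by rwa [← Measure.volume_eq_prod]),
    setIntegral_congr_fun measurableSet_Ioo hpt, integral_neg]
  congr 1
  -- The period is recentred at `t₀`. Since `ε < π`, no nonzero multiple of `2 * π` brings another
  -- parameter of it into `I`, so `f` vanishes on the rest of this period.
  have e1 := hper.intervalIntegral_add_eq (t₀ - π) 0
  rw [zero_add] at e1
  rw [← e1, intervalIntegral.integral_of_le (by linarith [Real.pi_pos])]
  symm
  refine setIntegral_eq_of_subset_of_forall_sdiff_eq_zero measurableSet_Ioc
    (fun t ht => ⟨by linarith [ht.1], by linarith [ht.2]⟩) ?_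
  rintro t ⟨ht, htI⟩
  have : f (c t) = 0 := by
    apply image_eq_zero_of_notMem_tsupport
    intro hmem
    obtain ⟨n, hn⟩ := hnear t (Metric.mem_ball.1 (hU' hmem).2.2)
    have hn0 : |(n : ℝ)| < 1 := by
      rw [abs_lt]
      constructor <;> nlinarith [ht.1, ht.2, hn.1, hn.2, Real.pi_pos]
    have : n = 0 := by rw [← Int.abs_lt_one_iff]; exact_mod_cast hn0
    rw [this, Int.cast_zero, zero_mul, add_zero] at hn
    exact htI hn
  rw [this, zero_mul]

/-- The formula is linear in the direction, and the chart provides it for two independent ones. -/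
lemma IsRegularLoop.exists_hasGreenFormula {c : ℝ → ℝ × ℝ} (hc : IsRegularLoop c)
    {S : Set (ℝ × ℝ)} (hSo : IsOpen S) (hS : frontier S = range c) {t₀ : ℝ} (hl : IsSide c S 1 t₀)
    (hr : ¬ IsSide c S (-1) t₀) (a : ℝ × ℝ) :
    ∀ᶠ U in (𝓝 (c t₀)).smallSets, ∀ f : ℝ × ℝ → ℝ, ContDiff ℝ 1 f → HasCompactSupport f →
      tsupport f ⊆ U → HasGreenFormula c S f a := by
  obtain ⟨η, ε, r, h⟩ := hc.exists_isLocalChart t₀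
  filter_upwards [h.exists_hasGreenFormula hc hSo hS hl hr (h.normal_mem t₀ (h.subset h.mem_Ioo)),
    h.exists_hasGreenFormula hc hSo hS hl hr h.oblique_mem] with U h1 h2 f hf hfc hfU
  set v := rotate90 (deriv c t₀)
  set w := v + deriv c t₀
  have hvw : cross v w ≠ 0 := by
    have := (cross_rotate90_self_pos (hc.regular t₀)).ne'
    contrapose! this
    simp only [w, cross_add_right, cross_right_self, zero_add] at this
    simp only [v, cross] at this ⊢
    linarith
  have g1 := h1 f hf hfU
  have g2 := h2 f hf hfU
  have hcc := hc.continuous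
  have hcd := hc.continuous_deriv
  have hfcont := hf.continuous
  have hi : ∀ u, IntegrableOn (fun p => fderiv ℝ f p u) S := fun u => by
    refine (Continuous.integrable_of_hasCompactSupport ?_ ?_).integrableOn
    · exact (hf.continuous_fderiv one_ne_zero).clm_apply continuous_const
    · exact hfc.fderiv_apply ℝ u
  unfold HasGreenFormula at *
  set α := cross a w / cross v w
  set β := cross v a / cross v w
  have ha : a = α • v + β • w := cross_cramer hvw a
  have e1 : ∀ p, fderiv ℝ f p a = α * fderiv ℝ f p v + β * fderiv ℝ f p w := fun p => by
    conv_lhs => rw [ha]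
    simp
  have e2 : ∀ t, f (c t) * cross (deriv c t) a = α * (f (c t) * cross (deriv c t) v) +
      β * (f (c t) * cross (deriv c t) w) := fun t => by
    conv_lhs => rw [ha]
    rw [cross_add_right, cross_smul_right, cross_smul_right]; ring
  simp only [e1, e2]
  rw [integral_add ((hi v).const_mul α) ((hi w).const_mul β), integral_const_mul,
    integral_const_mul, g1, g2, intervalIntegral.integral_add,
    intervalIntegral.integral_const_mul, intervalIntegral.integral_const_mul]
  · ring
  all_goals
    apply Continuous.intervalIntegrable
    fun_prop

/-- Both sides vanish: `f` is zero on the curve, and a directional derivative of a compactly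
supported function has integral zero. -/
lemma hasGreenFormula_of_tsupport_subset {c : ℝ → ℝ × ℝ} {S : Set (ℝ × ℝ)} (hSo : IsOpen S)
    (hS : frontier S = range c) {f : ℝ × ℝ → ℝ} (hf : ContDiff ℝ 1 f) (hfc : HasCompactSupport f)
    (hfS : tsupport f ⊆ S) (a : ℝ × ℝ) : HasGreenFormula c S f a := by
  have h0 : ∀ t, f (c t) = 0 := fun t => by
    apply image_eq_zero_of_notMem_tsupport
    intro h
    have : c t ∈ frontier S := hS ▸ mem_range_self t
    rw [hSo.frontier_eq] at this
    exact this.2 (hfS h)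
  have hi : Integrable (fun p => fderiv ℝ f p a) := by
    refine Continuous.integrable_of_hasCompactSupport ?_ ?_
    · exact (hf.continuous_fderiv one_ne_zero).clm_apply continuous_const
    · exact hfc.fderiv_apply ℝ a
  rw [HasGreenFormula, setIntegral_eq_integral_of_forall_compl_eq_zero]
  · simp only [h0, zero_mul, intervalIntegral.integral_zero, neg_zero]
    have := integral_mul_fderiv_eq_neg_fderiv_mul_of_integrable (μ := volume)
      (f := fun _ : ℝ × ℝ => (1 : ℝ)) (g := f) (v := a) (by simp) (by simpa using hi)
      (by simpa using hf.continuous.integrable_of_hasCompactSupport hfc)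
      (by simp) (fun x _ => hf.differentiable one_ne_zero x)
    simpa using this
  · intro p hp
    have : fderiv ℝ f p = 0 := by
      have := mt (fun h => support_fderiv_subset ℝ (f := f) h) (fun h => hp (hfS h))
      simpa using this
    rw [this]; simp

open scoped Manifold in
/-- **Green's formula** for the area of a domain lying to the left of its boundary. -/
lemma IsRegularLoop.integral_eq_area_of_isSide {c : ℝ → ℝ × ℝ} (hc : IsRegularLoop c)
    {S : Set (ℝ × ℝ)} (hSo : IsOpen S) (hSb : Bornology.IsBounded S) (hS : frontier S = range c)
    (hl : ∀ t, IsSide c S 1 t) (hr : ∀ t, ¬ IsSide c S (-1) t) :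
    ∫ t in (0 : ℝ)..(2 * π), (c t).1 * (deriv c t).2 = volume.real S := by
  -- The field `p.1 • a` has divergence `1`, and `cross (deriv c t) a = -(deriv c t).2`.
  set a : ℝ × ℝ := (1, 0)
  have hK : IsCompact (closure S) := hSb.isCompact_closure
  have hloc : ∀ p ∈ closure S, ∃ U, IsOpen U ∧ p ∈ U ∧ Bornology.IsBounded U ∧
      ∀ f : ℝ × ℝ → ℝ, ContDiff ℝ 1 f → HasCompactSupport f → tsupport f ⊆ U →
        HasGreenFormula c S f a := by
    intro p hp
    rw [closure_eq_self_union_frontier, hS] at hp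
    rcases hp with hp | ⟨t₀, rfl⟩
    · exact ⟨S, hSo, hp, hSb, fun f hf hfc hfS =>
        hasGreenFormula_of_tsupport_subset hSo hS hf hfc hfS a⟩
    · obtain ⟨U, hU, hUf⟩ := eventually_smallSets.1
        (hc.exists_hasGreenFormula hSo hS (hl t₀) (hr t₀) a)
      obtain ⟨V, hVU, hVo, hcV⟩ := mem_nhds_iff.1 hU
      refine ⟨V ∩ Metric.ball (c t₀) 1, hVo.inter Metric.isOpen_ball, ⟨hcV, by simp⟩,
        Metric.isBounded_ball.subset inter_subset_right, ?_⟩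
      exact hUf _ (inter_subset_left.trans hVU)
  choose! U hUo hmU hUb hUg using hloc
  obtain ⟨T, hTK, hT⟩ := hK.elim_nhds_subcover U fun p hp => (hUo p hp).mem_nhds (hmU p hp)
  obtain ⟨ρ, hρ⟩ := SmoothPartitionOfUnity.exists_isSubordinate 𝓘(ℝ, ℝ × ℝ) isClosed_closure
    (fun i : T => U i) (fun i => hUo i (hTK i i.2)) (fun p hp => by
      obtain ⟨x, hx, hpx⟩ := mem_iUnion₂.1 (hT hp)
      exact mem_iUnion.2 ⟨⟨x, hx⟩, hpx⟩)
  have hρs : ∀ i, ContDiff ℝ 1 (ρ i) := fun i => (ρ i).contMDiff.contDiff.of_le (by simp)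
  set f : T → ℝ × ℝ → ℝ := fun i p => ρ i p * p.1 with hfdef
  have hfs : ∀ i, ContDiff ℝ 1 (f i) := fun i => (hρs i).mul contDiff_fst
  have hts : ∀ i, tsupport (f i) ⊆ U i := fun i =>
    (tsupport_mul_subset_left).trans (hρ i)
  have hfc : ∀ i, HasCompactSupport (f i) := fun i =>
    ((hUb i (hTK i i.2)).subset (hts i)).isCompact_closure.of_isClosed_subset
      (isClosed_tsupport _) subset_closure
  have hsum : ∀ p ∈ closure S, ∑ i, f i p = p.1 := fun p hp => by
    rw [hfdef, ← Finset.sum_mul, ← finsum_eq_sum_of_fintype, ρ.sum_eq_one hp, one_mul]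
  have hg : ∀ i, HasGreenFormula c S (f i) a := fun i =>
    hUg i (hTK i i.2) _ (hfs i) (hfc i) (hts i)
  have hcc := hc.continuous
  have hcd := hc.continuous_deriv
  have hL : ∑ i, ∫ p in S, fderiv ℝ (f i) p a = volume.real S := by
    rw [← integral_finsetSum]
    · rw [setIntegral_congr_fun (g := fun _ => (1 : ℝ)) hSo.measurableSet]
      · simp
      · intro p hp
        -- The cut-off pieces add up to the first coordinate on all of the open set `S`, so their
        -- derivatives add up too.
        have e : (fun p => ∑ i, f i p) =ᶠ[𝓝 p] Prod.fst := by
          filter_upwards [hSo.mem_nhds hp] with q hq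
          exact hsum q (subset_closure hq)
        have e2 := e.fderiv_eq (𝕜 := ℝ)
        rw [fderiv_fun_sum fun i _ => (hfs i).differentiable one_ne_zero p, fderiv_fst] at e2
        have := congrArg (fun L : ℝ × ℝ →L[ℝ] ℝ => L a) e2
        simpa [a] using this
    · intro i _
      refine (Continuous.integrable_of_hasCompactSupport ?_ ?_).integrableOn
      · exact ((hfs i).continuous_fderiv one_ne_zero).clm_apply continuous_const
      · exact (hfc i).fderiv_apply ℝ a
  have hR : ∑ i, ∫ t in (0 : ℝ)..(2 * π), f i (c t) * cross (deriv c t) a =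
      -∫ t in (0 : ℝ)..(2 * π), (c t).1 * (deriv c t).2 := by
    rw [← intervalIntegral.integral_finsetSum, ← intervalIntegral.integral_neg]
    · congr 1; ext t
      rw [← Finset.sum_mul, hsum _ (frontier_subset_closure (hS ▸ mem_range_self t))]
      simp [cross, a]
    · intro i _
      have := (hfs i).continuous
      apply Continuous.intervalIntegrable
      fun_prop
  rw [← hL, Finset.sum_congr rfl fun i _ => hg i, Finset.sum_neg_distrib, hR, neg_neg]

/-- The area enclosed by a simple closed curve, up to the orientation of the curve. -/
theorem IsRegularLoop.abs_integral_eq_area {c : ℝ → ℝ × ℝ} (hc : IsRegularLoop c)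
    {S : Set (ℝ × ℝ)} (hSo : IsOpen S) (hSb : Bornology.IsBounded S)
    (hS : frontier S = range c) :
    |∫ t in (0 : ℝ)..(2 * π), (c t).1 * (deriv c t).2| = volume.real S := by
  rcases hc.exists_side hSo hSb hS with ⟨hl, hr⟩ | ⟨hl, hr⟩
  · rw [hc.integral_eq_area_of_isSide hSo hSb hS hl hr, abs_of_nonneg measureReal_nonneg]
  · have hS' : frontier S = range fun t => c (-t) := by
      rw [hS]; exact ((Equiv.neg ℝ).surjective.range_comp c).symm
    have h := hc.reverse.integral_eq_area_of_isSide hSo hSb hS'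
      (fun t => isSide_reverse_iff.2 (hl _)) (fun t => mt isSide_reverse_iff.1 (by
        rw [neg_neg]; exact hr _))
    have hper : Function.Periodic (fun t => (c t).1 * (deriv c t).2) (2 * π) := fun t => by
      have hd := hc.periodic.deriv' t
      simp only [hc.periodic t, hd]
    have e := hper.intervalIntegral_add_eq (-(2 * π)) 0
    rw [neg_add_cancel, zero_add] at e
    simp only [deriv_comp_neg, Prod.snd_neg, mul_neg, intervalIntegral.integral_neg] at h
    rw [intervalIntegral.integral_comp_neg (fun t => (c t).1 * (deriv c t).2), neg_zero, e] at h
    rw [← h, abs_of_nonpos]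
    linarith [measureReal_nonneg (μ := (volume : Measure (ℝ × ℝ))) (s := S)]

/-! ### Wirtinger's inequality and the isoperimetric inequality. -/

/-- **Wirtinger's inequality** for periodic functions of mean zero. -/
theorem integral_norm_sq_le_integral_norm_deriv_sq {w : ℝ → ℂ} (hw : ContDiff ℝ 1 w)
    (hper : Function.Periodic w (2 * π)) (hmean : ∫ t in (0 : ℝ)..(2 * π), w t = 0) :
    ∫ t in (0 : ℝ)..(2 * π), ‖w t‖ ^ 2 ≤ ∫ t in (0 : ℝ)..(2 * π), ‖deriv w t‖ ^ 2 := by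
  have hπ : (0 : ℝ) < 2 * π := two_pi_pos
  have hcd : Continuous (deriv w) := hw.continuous_deriv le_rfl
  have hL2 : ∀ {g : ℝ → ℂ}, Continuous g → MemLp g 2 (volume.restrict (Ioc 0 (2 * π))) :=
    fun {g} hg => by
      obtain ⟨C, hC⟩ := (isCompact_Icc (a := (0 : ℝ)) (b := 2 * π)).exists_bound_of_continuousOn
        hg.continuousOn
      refine MemLp.of_bound hg.aestronglyMeasurable C ?_
      filter_upwards [ae_restrict_mem measurableSet_Ioc] with t ht
      exact hC t (Ioc_subset_Icc_self ht)
  have s1 := hasSum_sq_fourierCoeffOn hπ (hL2 hw.continuous)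
  have s2 := hasSum_sq_fourierCoeffOn hπ (hL2 hcd)
  have hle : ∀ n : ℤ, ‖fourierCoeffOn hπ w n‖ ^ 2 ≤ ‖fourierCoeffOn hπ (deriv w) n‖ ^ 2 := by
    intro n
    rcases eq_or_ne n 0 with rfl | hn
    · have : fourierCoeffOn hπ w 0 = 0 := by
        rw [fourierCoeffOn_eq_integral]; simp [hmean]
      rw [this]; simp
    · have hp0 : w (2 * π) - w 0 = 0 := by
        have := hper 0; rw [zero_add] at this; rw [this, sub_self]
      have e := fourierCoeffOn_of_hasDerivAt hπ hn
        (fun x _ => (hw.differentiable one_ne_zero x).hasDerivAt) (hcd.intervalIntegrable _ _)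
      rw [hp0, mul_zero, zero_sub] at e
      -- Periodicity has removed the boundary term, so differentiation multiplies the coefficient by
      -- `i n`, of modulus at least one; Parseval then compares the two integrals.
      have e' : fourierCoeffOn hπ (deriv w) n = (Complex.I * n) * fourierCoeffOn hπ w n := by
        have hnC : (n : ℂ) ≠ 0 := by exact_mod_cast hn
        have hπC : (π : ℂ) ≠ 0 := by exact_mod_cast Real.pi_ne_zero
        have hI := Complex.I_ne_zero
        rw [e]; push_cast; field_simp; ring
      rw [e', norm_mul, norm_mul, Complex.norm_I, one_mul, mul_pow]
      have h1 : (1 : ℝ) ≤ ‖(n : ℂ)‖ := by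
        rw [Complex.norm_intCast]; exact_mod_cast Int.one_le_abs hn
      exact le_mul_of_one_le_left (sq_nonneg _) (one_le_pow₀ h1)
  have := hasSum_le hle s1 s2
  rw [smul_eq_mul, smul_eq_mul] at this
  exact le_of_mul_le_mul_left this (by rw [sub_zero]; positivity)

lemma intervalIntegral_deriv_eq_zero {E : Type*} [NormedAddCommGroup E] [NormedSpace ℝ E]
    [CompleteSpace E] {z : ℝ → E} {T : ℝ} (hz : ContDiff ℝ 1 z) (hper : Function.Periodic z T) :
    ∫ t in (0 : ℝ)..T, deriv z t = 0 := by
  have h0 := hper 0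
  rw [zero_add] at h0
  rw [intervalIntegral.integral_deriv_eq_sub
    (fun t _ => hz.differentiable one_ne_zero t)
    ((hz.continuous_deriv le_rfl).intervalIntegrable _ _), h0, sub_self]

/-- The isoperimetric inequality for a closed curve of constant speed, with the rigidity of its
equality case. -/
theorem isoperimetric_of_norm_deriv_eq {z : ℝ → ℂ} (hz : ContDiff ℝ 1 z)
    (hper : Function.Periodic z (2 * π)) {ρ : ℝ} (hρ : ∀ t, ‖deriv z t‖ = ρ) :
    ∫ t in (0 : ℝ)..(2 * π), (conj (z t) * deriv z t).im ≤ 2 * π * ρ ^ 2 ∧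
    (∫ t in (0 : ℝ)..(2 * π), (conj (z t) * deriv z t).im = 2 * π * ρ ^ 2 →
      ∃ m R, ∀ t, ‖z t - m‖ = R) := by
  have hπ : (0 : ℝ) < 2 * π := two_pi_pos
  have hcz := hz.continuous
  have hcd : Continuous (deriv z) := hz.continuous_deriv le_rfl
  set m : ℂ := (2 * π : ℝ)⁻¹ • ∫ t in (0 : ℝ)..(2 * π), z t with hm
  set w : ℝ → ℂ := fun t => z t - m with hwdef
  have hw : ContDiff ℝ 1 w := hz.sub contDiff_const
  have hwper : Function.Periodic w (2 * π) := fun t => by simp only [hwdef, hper t]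
  have hcw := hw.continuous
  have hdw : deriv w = deriv z := by ext t; simp [hwdef]
  have hmean : ∫ t in (0 : ℝ)..(2 * π), w t = 0 := by
    rw [intervalIntegral.integral_sub (hcz.intervalIntegrable _ _) (by simp),
      intervalIntegral.integral_const, sub_zero, hm, smul_smul, mul_inv_cancel₀ hπ.ne', one_smul,
      sub_self]
  have hW := integral_norm_sq_le_integral_norm_deriv_sq hw hwper hmean
  have hD : ∫ t in (0 : ℝ)..(2 * π), ‖deriv w t‖ ^ 2 = 2 * π * ρ ^ 2 := by
    simp [hdw, hρ]
  -- Translating the curve changes the area integrand by the derivative of a periodic function.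
  have harea : ∫ t in (0 : ℝ)..(2 * π), (conj (z t) * deriv z t).im =
      ∫ t in (0 : ℝ)..(2 * π), (conj (w t) * deriv w t).im := by
    have e : ∀ t, (conj (z t) * deriv z t).im =
        (conj (w t) * deriv w t).im + deriv (fun t => (conj m * z t).im) t := fun t => by
      have hd : HasDerivAt (fun t => (conj m * z t).im) (conj m * deriv z t).im t := by
        have := ((hz.differentiable one_ne_zero t).hasDerivAt.const_mul (conj m))
        exact Complex.imCLM.hasFDerivAt.comp_hasDerivAt t this
      rw [hd.deriv, hdw]
      simp only [hwdef, map_sub, sub_mul, Complex.sub_im]; ring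
    have hcd1 : ContDiff ℝ 1 (fun t => (conj m * z t).im) :=
      Complex.imCLM.contDiff.comp (contDiff_const.mul hz)
    simp only [e]
    rw [intervalIntegral.integral_add, intervalIntegral_deriv_eq_zero hcd1, add_zero]
    · intro t; simp only [hper t]
    · apply Continuous.intervalIntegrable
      rw [hdw]
      exact Complex.continuous_im.comp ((Complex.continuous_conj.comp hcw).mul hcd)
    · exact (hcd1.continuous_deriv le_rfl).intervalIntegrable _ _
  have hci : Continuous fun t => (conj (w t) * deriv w t).im := by
    rw [hdw]
    exact Complex.continuous_im.comp ((Complex.continuous_conj.comp hcw).mul hcd)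
  have hsq : ∀ t, ‖deriv w t - Complex.I * w t‖ ^ 2 =
      ‖deriv w t‖ ^ 2 + ‖w t‖ ^ 2 - 2 * (conj (w t) * deriv w t).im := fun t => by
    simp only [← Complex.normSq_eq_norm_sq, Complex.normSq_apply, Complex.sub_re, Complex.sub_im,
      Complex.mul_re, Complex.mul_im, Complex.I_re, Complex.I_im, Complex.conj_re,
      Complex.conj_im]
    ring
  have hcd' : Continuous (deriv w) := hdw ▸ hcd
  have hint : ∫ t in (0 : ℝ)..(2 * π), ‖deriv w t - Complex.I * w t‖ ^ 2 =
      2 * π * ρ ^ 2 + (∫ t in (0 : ℝ)..(2 * π), ‖w t‖ ^ 2) -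
        2 * ∫ t in (0 : ℝ)..(2 * π), (conj (w t) * deriv w t).im := by
    simp only [hsq]
    rw [intervalIntegral.integral_sub, intervalIntegral.integral_add,
      intervalIntegral.integral_const_mul, hD]
    all_goals
      apply Continuous.intervalIntegrable
      fun_prop
  have hnn : 0 ≤ ∫ t in (0 : ℝ)..(2 * π), ‖deriv w t - Complex.I * w t‖ ^ 2 :=
    intervalIntegral.integral_nonneg hπ.le fun t _ => by positivity
  rw [harea]
  -- Wirtinger bounds `∫ ‖w‖ ^ 2` by `2 * π * ρ ^ 2`, so nonnegativity of the square gives the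
  -- bound. Equality forces `w' = i w`, and then `‖w‖` is constant.
  refine ⟨by linarith, fun heq => ?_⟩
  have hzero : ∫ t in (0 : ℝ)..(2 * π), ‖deriv w t - Complex.I * w t‖ ^ 2 = 0 := by linarith
  have hpt : ∀ t ∈ Icc 0 (2 * π), deriv w t = Complex.I * w t := by
    intro t ht
    by_contra hne
    have hpos : 0 < ‖deriv w t - Complex.I * w t‖ ^ 2 := by
      have := norm_pos_iff.2 (sub_ne_zero.2 hne); positivity
    have := intervalIntegral.integral_pos hπ
      (f := fun t => ‖deriv w t - Complex.I * w t‖ ^ 2)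
      (Continuous.continuousOn (by fun_prop)) (fun t _ => by positivity) ⟨t, ht, hpos⟩
    linarith
  have hconst : ∀ t ∈ Icc 0 (2 * π), ‖w t‖ ^ 2 = ‖w 0‖ ^ 2 := by
    refine constant_of_has_deriv_right_zero (Continuous.continuousOn (by fun_prop)) fun t ht => ?_
    have h1 := (hw.differentiable one_ne_zero t).hasDerivAt
    rw [hpt t (Ico_subset_Icc_self ht)] at h1
    have h2 := h1.norm_sq
    have h3 : 2 * inner ℝ (w t) (Complex.I * w t) = 0 := by
      simp only [Complex.inner, Complex.mul_re, Complex.mul_im, Complex.I_re, Complex.I_im,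
        Complex.conj_re, Complex.conj_im]
      ring
    rw [h3] at h2
    exact h2.hasDerivWithinAt
  refine ⟨m, ‖w 0‖, fun t => ?_⟩
  obtain ⟨s, hs, hst⟩ := hwper.exists_mem_Ico₀ hπ t
  have := hconst s (Ico_subset_Icc_self hs)
  rw [← hst] at this
  exact (pow_left_inj₀ (norm_nonneg _) (norm_nonneg _) two_ne_zero).1 this

/-- Reparametrization of a closed curve to constant speed. -/
lemma exists_reparametrization {g : ℝ → ℂ} (hg : ContDiff ℝ 1 g)
    (hper : Function.Periodic g (2 * π)) (hreg : ∀ t, deriv g t ≠ 0) :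
    ∃ z : ℝ → ℂ, ContDiff ℝ 1 z ∧ Function.Periodic z (2 * π) ∧ range z = range g ∧
      (∀ t, ‖deriv z t‖ = (∫ t in (0 : ℝ)..(2 * π), ‖deriv g t‖) / (2 * π)) ∧
      ∫ t in (0 : ℝ)..(2 * π), (conj (z t) * deriv z t).im =
        ∫ t in (0 : ℝ)..(2 * π), (conj (g t) * deriv g t).im := by
  have hπ : (0 : ℝ) < 2 * π := two_pi_pos
  have hcg := hg.continuous
  have hcd : Continuous (deriv g) := hg.continuous_deriv le_rfl
  have hcn : Continuous fun t => ‖deriv g t‖ := hcd.norm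
  set L := ∫ t in (0 : ℝ)..(2 * π), ‖deriv g t‖ with hLdef
  have hL : 0 < L := intervalIntegral.intervalIntegral_pos_of_pos (hcn.intervalIntegrable _ _)
    (fun t => norm_pos_iff.2 (hreg t)) hπ
  -- Arc length rescaled to total `2 * π`: `θ` commutes with translation by a period, so its inverse
  -- `τ` keeps the reparametrized curve `2 * π`-periodic.
  set θ : ℝ → ℝ := fun t => 2 * π / L * ∫ s in (0 : ℝ)..t, ‖deriv g s‖ with hθ
  have hθd : ∀ t, HasDerivAt θ (2 * π / L * ‖deriv g t‖) t := fun t =>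
    (hcn.integral_hasStrictDerivAt 0 t).hasDerivAt.const_mul _
  have hθpos : ∀ t, 0 < 2 * π / L * ‖deriv g t‖ := fun t => by
    have := norm_pos_iff.2 (hreg t); positivity
  have hmono : StrictMono θ := strictMono_of_deriv_pos fun t => by
    rw [(hθd t).deriv]; exact hθpos t
  have hθc : Continuous θ := continuous_iff_continuousAt.2 fun t => (hθd t).continuousAt
  have hdper : Function.Periodic (fun t => ‖deriv g t‖) (2 * π) := fun t => by
    have hd := hper.deriv' t
    simp only [hd]
  have hθ0 : θ 0 = 0 := by simp [hθ]
  have hθper : ∀ t, θ (t + 2 * π) = θ t + 2 * π := fun t => by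
    simp only [hθ]
    rw [← intervalIntegral.integral_add_adjacent_intervals (b := t)
      (hcn.intervalIntegrable _ _) (hcn.intervalIntegrable _ _),
      hdper.intervalIntegral_add_eq t 0, zero_add, ← hLdef]
    field_simp
  have hθnat : ∀ n : ℕ, θ (n * (2 * π)) = n * (2 * π) := fun n => by
    induction n with
    | zero => simp [hθ0]
    | succ n ih => push_cast; rw [add_mul, one_mul, hθper, ih]
  have hθneg : ∀ n : ℕ, θ (-(n * (2 * π))) = -(n * (2 * π)) := fun n => by
    induction n with
    | zero => simp [hθ0]
    | succ n ih =>
      have := hθper (-((n + 1 : ℕ) * (2 * π)))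
      rw [show -(((n + 1 : ℕ) : ℝ) * (2 * π)) + 2 * π = -(n * (2 * π)) by push_cast; ring, ih] at this
      push_cast at this ⊢
      linarith
  have hsurj : Function.Surjective θ := fun y => by
    obtain ⟨n, hn⟩ := exists_nat_ge (|y| / (2 * π))
    rw [div_le_iff₀ hπ] at hn
    have hy := abs_le.1 hn
    have hnn : (0 : ℝ) ≤ n * (2 * π) := by positivity
    obtain ⟨t, -, ht⟩ := intermediate_value_Icc (f := θ)
      (show -((n : ℝ) * (2 * π)) ≤ n * (2 * π) by linarith) hθc.continuousOn
      (show y ∈ _ by rw [hθnat, hθneg]; exact hy)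
    exact ⟨t, ht⟩
  set e := hmono.orderIsoOfSurjective θ hsurj
  set τ : ℝ → ℝ := fun s => e.symm s
  have hθτ : ∀ s, θ (τ s) = s := fun s => e.apply_symm_apply s
  have hτθ : ∀ t, τ (θ t) = t := fun t => e.symm_apply_apply t
  have hτc : Continuous τ := e.symm.continuous
  have hτd : ∀ s, HasDerivAt τ (2 * π / L * ‖deriv g (τ s)‖)⁻¹ s := fun s =>
    HasDerivAt.of_local_left_inverse hτc.continuousAt (hθd (τ s)) (hθpos _).ne'
      (Eventually.of_forall hθτ)
  have hτper : ∀ s, τ (s + 2 * π) = τ s + 2 * π := fun s => by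
    apply hmono.injective
    rw [hθτ, hθper, hθτ]
  have hzd : ∀ s, HasDerivAt (fun s => g (τ s))
      ((2 * π / L * ‖deriv g (τ s)‖)⁻¹ • deriv g (τ s)) s := fun s =>
    (hg.differentiable one_ne_zero (τ s)).hasDerivAt.scomp s (hτd s)
  have hzd' : deriv (fun s => g (τ s)) =
      fun s => (2 * π / L * ‖deriv g (τ s)‖)⁻¹ • deriv g (τ s) := funext fun s => (hzd s).deriv
  have hzdc : Continuous (deriv fun s => g (τ s)) := by
    rw [hzd']
    refine Continuous.smul (Continuous.inv₀ (by fun_prop) fun s => (hθpos _).ne') (by fun_prop)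
  refine ⟨fun s => g (τ s), ?_, ?_, ?_, ?_, ?_⟩
  · rw [contDiff_one_iff_deriv]
    exact ⟨fun s => (hzd s).differentiableAt, hzdc⟩
  · intro s; simp only [hτper, hper _]
  · exact e.symm.surjective.range_comp g
  · intro s
    rw [hzd', norm_smul, norm_inv, Real.norm_of_nonneg (hθpos _).le]
    have := (norm_pos_iff.2 (hreg (τ s))).ne'
    field_simp
  · have hcz : Continuous fun s => g (τ s) := hcg.comp hτc
    have hcF : Continuous fun s => (conj (g (τ s)) * deriv (fun s => g (τ s)) s).im :=
      Complex.continuous_im.comp ((Complex.continuous_conj.comp hcz).mul hzdc)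
    have h2π : θ (2 * π) = 2 * π := by simpa using hθnat 1
    have key := intervalIntegral.integral_comp_mul_deriv (a := 0) (b := 2 * π)
      (fun t _ => hθd t) (by fun_prop) hcF
    rw [hθ0, h2π] at key
    rw [← key]
    congr 1; ext t
    have hne := (hθpos t).ne'
    rw [Function.comp_apply, hzd']
    simp only [hτθ, mul_smul_comm, Complex.smul_im, smul_eq_mul]
    rw [mul_comm, ← mul_assoc, mul_inv_cancel₀ hne, one_mul]

/-- The **isoperimetric inequality** for a regular closed curve of the plane, with the rigidity of
its equality case. -/
theorem isoperimetric {g : ℝ → ℂ} (hg : ContDiff ℝ 1 g) (hper : Function.Periodic g (2 * π))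
    (hreg : ∀ t, deriv g t ≠ 0) {A L : ℝ}
    (hA : |∫ t in (0 : ℝ)..(2 * π), (conj (g t) * deriv g t).im| = 2 * A)
    (hL : ∫ t in (0 : ℝ)..(2 * π), ‖deriv g t‖ = L) :
    4 * π * A ≤ L ^ 2 ∧ (4 * π * A = L ^ 2 → ∃ m R, ∀ t, ‖g t - m‖ = R) := by
  have hπ := Real.pi_pos
  have main : ∀ g : ℝ → ℂ, ContDiff ℝ 1 g → Function.Periodic g (2 * π) → (∀ t, deriv g t ≠ 0) →
      ∫ t in (0 : ℝ)..(2 * π), (conj (g t) * deriv g t).im = 2 * A →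
      ∫ t in (0 : ℝ)..(2 * π), ‖deriv g t‖ = L →
      4 * π * A ≤ L ^ 2 ∧ (4 * π * A = L ^ 2 → ∃ m R, ∀ t, ‖g t - m‖ = R) := by
    intro g hg hper hreg hA hL
    obtain ⟨z, hz, hzper, hrange, hspeed, harea⟩ := exists_reparametrization hg hper hreg
    rw [hL] at hspeed
    rw [hA] at harea
    obtain ⟨h1, h2⟩ := isoperimetric_of_norm_deriv_eq hz hzper hspeed
    rw [harea] at h1 h2
    have e : 2 * π * (L / (2 * π)) ^ 2 = L ^ 2 / (2 * π) := by field_simp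
    rw [e] at h1 h2
    rw [le_div_iff₀ (by positivity)] at h1
    refine ⟨by linarith, fun heq => ?_⟩
    obtain ⟨m, R, hmR⟩ := h2 (by rw [eq_div_iff (by positivity)]; linarith)
    refine ⟨m, R, fun t => ?_⟩
    obtain ⟨s, hs⟩ : g t ∈ range z := hrange ▸ mem_range_self t
    rw [← hs]; exact hmR s
  rcases le_total 0 (∫ t in (0 : ℝ)..(2 * π), (conj (g t) * deriv g t).im) with h | h
  · rw [abs_of_nonneg h] at hA
    exact main g hg hper hreg hA hL
  · rw [abs_of_nonpos h] at hA
    have hd : ∀ t, deriv (fun t => conj (g t)) t = conj (deriv g t) := fun t =>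
      (Complex.conjCLE.toContinuousLinearMap.hasFDerivAt.comp_hasDerivAt t
        (hg.differentiable one_ne_zero t).hasDerivAt).deriv
    -- Conjugation reverses the sign of the area and preserves lengths and circles.
    obtain ⟨h1, h2⟩ := main (fun t => conj (g t)) (Complex.conjCLE.contDiff.comp hg)
      (fun t => by simp only [hper t]) (fun t => by rw [hd]; simpa using hreg t)
      (by
        rw [← hA, ← intervalIntegral.integral_neg]
        congr 1; ext t
        rw [hd, ← map_mul, Complex.conj_im])
      (by simpa only [hd, RCLike.norm_conj] using hL)
    refine ⟨h1, fun heq => ?_⟩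
    obtain ⟨m, R, hmR⟩ := h2 heq
    refine ⟨conj m, R, fun t => ?_⟩
    rw [← hmR t, ← RCLike.norm_conj (g t - conj m), map_sub, Complex.conj_conj]

/-! ### The spectrum of the closed curve. -/

lemma magneticDeriv_const_mul (β : ℝ) (γ : ℝ → Plane) (k : ℂ) (u : ℝ → ℂ) (t : ℝ) :
    magneticDeriv β γ (fun t => k * u t) t = k * magneticDeriv β γ u t := by
  simp only [magneticDeriv, deriv_const_mul_field]
  ring

lemma magneticDeriv_add (β : ℝ) (γ : ℝ → Plane) {u v : ℝ → ℂ} {t : ℝ}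
    (hu : DifferentiableAt ℝ u t) (hv : DifferentiableAt ℝ v t) :
    magneticDeriv β γ (fun t => u t + v t) t = magneticDeriv β γ u t + magneticDeriv β γ v t := by
  simp only [magneticDeriv, deriv_fun_add hu hv]
  ring

/-- The circulation of the standard potential along the closed curve `γ`. -/
noncomputable def circulation (β : ℝ) (γ : ℝ → Plane) : ℝ :=
  ∫ t in (0 : ℝ)..(2 * π), standardPotential β (γ t) (deriv γ t)

namespace IsBoundaryCurve

variable {γ : ℝ → Plane} {Ω : Set Plane} (hγ : IsBoundaryCurve γ Ω)

include hγ

lemma contDiff_deriv : ContDiff ℝ ∞ (deriv γ) := (contDiff_infty_iff_deriv.1 hγ.smooth).2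

lemma contDiff_norm_deriv : ContDiff ℝ ∞ fun t => ‖deriv γ t‖ :=
  hγ.contDiff_deriv.norm ℝ hγ.regular

lemma contDiff_coord (i : Fin 2) : ContDiff ℝ ∞ fun t => γ t i := contDiff_euclidean.1 hγ.smooth i

lemma contDiff_deriv_coord (i : Fin 2) : ContDiff ℝ ∞ fun t => deriv γ t i :=
  contDiff_euclidean.1 hγ.contDiff_deriv i

lemma contDiff_potential (β : ℝ) :
    ContDiff ℝ ∞ fun t => standardPotential β (γ t) (deriv γ t) :=
  contDiff_const.mul (((hγ.contDiff_coord 1).neg.mul (hγ.contDiff_deriv_coord 0)).add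
    ((hγ.contDiff_coord 0).mul (hγ.contDiff_deriv_coord 1)))

lemma norm_deriv_pos (t : ℝ) : 0 < ‖deriv γ t‖ := norm_pos_iff.2 (hγ.regular t)

lemma curveLength_pos : 0 < curveLength γ :=
  intervalIntegral.intervalIntegral_pos_of_pos
    (hγ.contDiff_norm_deriv.continuous.intervalIntegrable _ _) hγ.norm_deriv_pos two_pi_pos

/-- The solution `exp (i (∫ Â + k s))` of the first order equation `∇_T u = i k u`. -/
lemma hasDerivAt_exp (β : ℝ) (k : ℂ) (t : ℝ) :
    HasDerivAt (fun t : ℝ => Complex.exp (Complex.I *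
      (((∫ s in (0 : ℝ)..t, standardPotential β (γ s) (deriv γ s) : ℝ) : ℂ) +
        k * ((∫ s in (0 : ℝ)..t, ‖deriv γ s‖ : ℝ) : ℂ))))
      (Complex.exp (Complex.I *
      (((∫ s in (0 : ℝ)..t, standardPotential β (γ s) (deriv γ s) : ℝ) : ℂ) +
        k * ((∫ s in (0 : ℝ)..t, ‖deriv γ s‖ : ℝ) : ℂ))) *
        (Complex.I * ((standardPotential β (γ t) (deriv γ t) : ℂ) + k * (‖deriv γ t‖ : ℂ)))) t := by
  have h1 := ((hγ.contDiff_potential β).continuous.integral_hasStrictDerivAt 0 t).hasDerivAt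
  have h2 := (hγ.contDiff_norm_deriv.continuous.integral_hasStrictDerivAt 0 t).hasDerivAt
  exact ((h1.ofReal_comp.add (h2.ofReal_comp.const_mul k)).const_mul Complex.I).cexp

/-- The first order equation `∇_T v = i k v` has a nonzero solution on the closed curve only for
the wave numbers `k` compatible with the circulation of the potential. -/
lemma eq_zero_or_exists_wave_number (β : ℝ) {v : ℝ → ℂ} (hv : Differentiable ℝ v)
    (hper : Function.Periodic v (2 * π)) {k : ℂ}
    (h : ∀ t, magneticDeriv β γ v t = Complex.I * k * v t) :
    (∀ t, v t = 0) ∨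
      ∃ n : ℤ, k = (((2 * π * n - circulation β γ) / curveLength γ : ℝ) : ℂ) := by
  have hd : ∀ t, HasDerivAt v (Complex.I * ((standardPotential β (γ t) (deriv γ t) : ℂ) +
      k * (‖deriv γ t‖ : ℂ)) * v t) t := fun t => by
    have h1 := h t
    have h2 : (‖deriv γ t‖ : ℂ) ≠ 0 := by exact_mod_cast (hγ.norm_deriv_pos t).ne'
    rw [magneticDeriv, div_eq_iff h2] at h1
    exact (hv t).hasDerivAt.congr_deriv (by linear_combination h1)
  set E : ℝ → ℂ := fun t => Complex.exp (Complex.I *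
      (((∫ s in (0 : ℝ)..t, standardPotential β (γ s) (deriv γ s) : ℝ) : ℂ) +
        k * ((∫ s in (0 : ℝ)..t, ‖deriv γ s‖ : ℝ) : ℂ))) with hE
  have hEd := fun t => hγ.hasDerivAt_exp β k t
  have hE0 : ∀ t, E t ≠ 0 := fun t => Complex.exp_ne_zero _
  have hconst : ∀ t, v t / E t = v 0 / E 0 := by
    have hq : ∀ t, HasDerivAt (fun t => v t / E t) 0 t := fun t => by
      refine ((hd t).div (hEd t) (hE0 t)).congr_deriv ?_
      rw [div_eq_zero_iff]; left; ring
    exact fun t => is_const_of_deriv_eq_zero (fun t => (hq t).differentiableAt)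
      (fun t => (hq t).deriv) t 0
  have hE00 : E 0 = 1 := by simp [hE]
  have hsol : ∀ t, v t = v 0 * E t := fun t => by
    have := hconst t
    rwa [hE00, div_one, div_eq_iff (hE0 t)] at this
  by_cases hv0 : v 0 = 0
  · left; intro t; rw [hsol, hv0, zero_mul]
  right
  have h2π := hper 0
  rw [zero_add, hsol] at h2π
  have hE2 : E (2 * π) = 1 := mul_left_cancel₀ hv0 (by rw [h2π, mul_one])
  obtain ⟨n, hn⟩ := Complex.exp_eq_one_iff.1 hE2
  refine ⟨n, ?_⟩
  change Complex.I * ((circulation β γ : ℂ) + k * (curveLength γ : ℂ)) = _ at hn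
  have hL : (curveLength γ : ℂ) ≠ 0 := by exact_mod_cast hγ.curveLength_pos.ne'
  have hn' : (circulation β γ : ℂ) + k * (curveLength γ : ℂ) = 2 * π * n :=
    mul_left_cancel₀ Complex.I_ne_zero (by rw [hn]; ring)
  push_cast
  rw [eq_div_iff hL]
  linear_combination hn'

lemma contDiff_magneticDeriv (β : ℝ) {u : ℝ → ℂ} (hu : ContDiff ℝ ∞ u) :
    ContDiff ℝ ∞ (magneticDeriv β γ u) := by
  have h1 : ContDiff ℝ ∞ fun t => (standardPotential β (γ t) (deriv γ t) : ℂ) :=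
    Complex.ofRealCLM.contDiff.comp (hγ.contDiff_potential β)
  have h2 : ContDiff ℝ ∞ fun t => (‖deriv γ t‖ : ℂ) :=
    Complex.ofRealCLM.contDiff.comp hγ.contDiff_norm_deriv
  have h3 := (contDiff_infty_iff_deriv.1 hu).2
  have h4 : ContDiff ℝ ∞ fun t => (‖deriv γ t‖ : ℂ)⁻¹ := h2.inv fun t => by
    exact_mod_cast (hγ.norm_deriv_pos t).ne'
  have h5 := (h3.sub (((contDiff_const (c := Complex.I)).mul h1).mul hu)).mul h4
  simp only [← div_eq_mul_inv] at h5
  exact h5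

lemma periodic_potential (β : ℝ) :
    Function.Periodic (fun t => standardPotential β (γ t) (deriv γ t)) (2 * π) := fun t => by
  simp only [hγ.periodic t, hγ.periodic.deriv' t]

lemma periodic_norm_deriv : Function.Periodic (fun t => ‖deriv γ t‖) (2 * π) := fun t => by
  simp only [hγ.periodic.deriv' t]

lemma periodic_magneticDeriv (β : ℝ) {u : ℝ → ℂ} (hu : Function.Periodic u (2 * π)) :
    Function.Periodic (magneticDeriv β γ u) (2 * π) := fun t => by
  simp only [magneticDeriv, hu t, hu.deriv' t, hγ.periodic t, hγ.periodic.deriv' t]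

/-- The explicit exponential is an eigenfunction: this wave number makes its phase grow by `2 * π *
n` over one period. -/
lemma sq_mem_curveEigenvalues (β : ℝ) (n : ℤ) :
    ((2 * π * n - circulation β γ) / curveLength γ) ^ 2 ∈ curveEigenvalues β γ := by
  set k : ℝ := (2 * π * n - circulation β γ) / curveLength γ with hk
  set u : ℝ → ℂ := fun t => Complex.exp (Complex.I *
      (((∫ s in (0 : ℝ)..t, standardPotential β (γ s) (deriv γ s) : ℝ) : ℂ) +
        (k : ℂ) * ((∫ s in (0 : ℝ)..t, ‖deriv γ s‖ : ℝ) : ℂ))) with hu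
  have hd := fun t => hγ.hasDerivAt_exp β k t
  have hprim : ∀ {f : ℝ → ℝ}, ContDiff ℝ ∞ f → ContDiff ℝ ∞ fun t => ∫ s in (0 : ℝ)..t, f s := by
    intro f hf
    have h1 := fun t => (hf.continuous.integral_hasStrictDerivAt 0 t).hasDerivAt
    rw [contDiff_infty_iff_deriv]
    refine ⟨fun t => (h1 t).differentiableAt, ?_⟩
    rwa [show deriv (fun t => ∫ s in (0 : ℝ)..t, f s) = f from funext fun t => (h1 t).deriv]
  have hquasi : ∀ {f : ℝ → ℝ}, Continuous f → Function.Periodic f (2 * π) → ∀ t,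
      ∫ s in (0 : ℝ)..(t + 2 * π), f s =
        (∫ s in (0 : ℝ)..t, f s) + ∫ s in (0 : ℝ)..(2 * π), f s := fun hf hp t => by
    rw [← intervalIntegral.integral_add_adjacent_intervals (b := t)
      (hf.intervalIntegrable _ _) (hf.intervalIntegrable _ _), hp.intervalIntegral_add_eq t 0,
      zero_add]
  have hmag : ∀ t, magneticDeriv β γ u t = Complex.I * k * u t := fun t => by
    have h2 : (‖deriv γ t‖ : ℂ) ≠ 0 := by exact_mod_cast (hγ.norm_deriv_pos t).ne'
    rw [magneticDeriv, (hd t).deriv, div_eq_iff h2]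
    simp only [hu]; ring
  refine ⟨u, ?_, ?_, ?_, ?_⟩
  · apply Complex.contDiff_exp.comp
    exact contDiff_const.mul ((Complex.ofRealCLM.contDiff.comp (hprim (hγ.contDiff_potential β))).add
      (contDiff_const.mul (Complex.ofRealCLM.contDiff.comp (hprim hγ.contDiff_norm_deriv))))
  · intro t
    simp only [hu]
    rw [hquasi (hγ.contDiff_potential β).continuous (hγ.periodic_potential β),
      hquasi hγ.contDiff_norm_deriv.continuous hγ.periodic_norm_deriv, Complex.exp_eq_exp_iff_exists_int]
    refine ⟨n, ?_⟩
    have e : circulation β γ + k * curveLength γ = 2 * π * n := by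
      rw [hk, div_mul_cancel₀ _ hγ.curveLength_pos.ne']; ring
    have e' : (circulation β γ : ℂ) + k * curveLength γ = 2 * π * n := by exact_mod_cast e
    rw [← circulation, ← curveLength]
    push_cast
    linear_combination Complex.I * e'
  · intro h0
    exact Complex.exp_ne_zero _ (congrFun h0 0)
  · intro t
    rw [curveMagneticLaplacian, show magneticDeriv β γ u = fun t => Complex.I * k * u t from
      funext hmag, magneticDeriv_const_mul, hmag]
    push_cast
    linear_combination (-(k : ℂ) ^ 2 * u t) * Complex.I_sq

/-- The spectrum of the magnetic Laplacian of a closed curve. -/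
theorem curveEigenvalues_eq (β : ℝ) : curveEigenvalues β γ =
    range fun n : ℤ => ((2 * π * n - circulation β γ) / curveLength γ) ^ 2 := by
  apply Subset.antisymm
  · rintro μ ⟨u, hu, hper, hne, heq⟩
    -- The root is taken in `ℂ` since the sign of `μ` is not yet known; the wave-number condition
    -- makes `k` real.
    obtain ⟨k, hk⟩ := IsAlgClosed.exists_pow_nat_eq (μ : ℂ) two_pos
    have key : ∀ n : ℤ, (μ : ℂ) = (((2 * π * n - circulation β γ) / curveLength γ : ℝ) : ℂ) ^ 2 →
        μ ∈ range fun n : ℤ => ((2 * π * n - circulation β γ) / curveLength γ) ^ 2 := fun n hn =>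
      ⟨n, by exact_mod_cast hn.symm⟩
    have hDu := hγ.contDiff_magneticDeriv β hu
    have hud : Differentiable ℝ u := hu.differentiable (by simp)
    have hDud : Differentiable ℝ (magneticDeriv β γ u) := hDu.differentiable (by simp)
    have hDper := hγ.periodic_magneticDeriv β hper
    -- The factor `(D + ik)u` of the eigenvalue equation is killed by `D - ik`. If it vanishes
    -- identically, `u` itself solves the first-order equation with `-k`.
    set v : ℝ → ℂ := fun t => magneticDeriv β γ u t + Complex.I * k * u t with hv
    have hvd : Differentiable ℝ v := hDud.add (hud.const_mul _)
    have hvper : Function.Periodic v (2 * π) := fun t => by simp only [hv, hper t, hDper t]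
    have hDv : ∀ t, magneticDeriv β γ v t = Complex.I * k * v t := fun t => by
      have h1 := heq t
      rw [curveMagneticLaplacian] at h1
      rw [hv, magneticDeriv_add β γ (hDud t) ((hud t).const_mul _), magneticDeriv_const_mul]
      linear_combination -h1 + u t * hk - (k ^ 2 * u t) * Complex.I_sq
    rcases hγ.eq_zero_or_exists_wave_number β hvd hvper hDv with h0 | ⟨n, hn⟩
    · rcases hγ.eq_zero_or_exists_wave_number β hud hper (k := -k)
        (fun t => by linear_combination h0 t) with h1 | ⟨n, hn⟩
      · exact absurd (funext h1) hne
      · exact key n (by rw [← hn, ← hk]; ring)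
    · exact key n (by rw [← hn, ← hk])
  · rintro _ ⟨n, rfl⟩
    exact hγ.sq_mem_curveEigenvalues β n

end IsBoundaryCurve

/-! ### Area, circulation and isoperimetry in the Euclidean plane. -/

/-- The identification of the plane with `ℝ × ℝ` by coordinates. -/
noncomputable def planeEquivProd : Plane ≃L[ℝ] ℝ × ℝ :=
  (EuclideanSpace.equiv (Fin 2) ℝ).trans (ContinuousLinearEquiv.finTwoArrow ℝ ℝ)

lemma planeEquivProd_apply (x : Plane) : planeEquivProd x = (x 0, x 1) := rfl

lemma measurePreserving_planeEquivProd : MeasurePreserving planeEquivProd :=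
  (volume_preserving_finTwoArrow ℝ).comp (PiLp.volume_preserving_ofLp (Fin 2))

lemma volume_real_image_planeEquivProd (S : Set Plane) :
    volume.real (planeEquivProd '' S) = volume.real S := by
  rw [measureReal_def, measureReal_def,
    ← measurePreserving_planeEquivProd.measure_preimage_emb
      planeEquivProd.toHomeomorph.measurableEmbedding,
    preimage_image_eq _ planeEquivProd.injective]

namespace IsBoundaryCurve

variable {γ : ℝ → Plane} {Ω : Set Plane} (hγ : IsBoundaryCurve γ Ω)

include hγ

lemma hasDerivAt_coord (i : Fin 2) (t : ℝ) : HasDerivAt (fun t => γ t i) (deriv γ t i) t :=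
  (EuclideanSpace.proj (𝕜 := ℝ) i).hasFDerivAt.comp_hasDerivAt t
    (hγ.smooth.differentiable (by simp) t).hasDerivAt

lemma isRegularLoop : IsRegularLoop fun t => planeEquivProd (γ t) where
  contDiff := (planeEquivProd.contDiff.comp hγ.smooth).of_le (by simp)
  periodic t := by simp only [hγ.periodic t]
  regular t := by
    have : HasDerivAt (fun t => planeEquivProd (γ t)) (planeEquivProd (deriv γ t)) t :=
      planeEquivProd.toContinuousLinearMap.hasFDerivAt.comp_hasDerivAt t
        (hγ.smooth.differentiable (by simp) t).hasDerivAt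
    rw [this.deriv]
    simpa using hγ.regular t
  injOn := planeEquivProd.injective.comp_injOn hγ.simple

lemma continuous_coord (i : Fin 2) : Continuous fun t => γ t i := (hγ.contDiff_coord i).continuous

lemma continuous_deriv_coord (i : Fin 2) : Continuous fun t => deriv γ t i :=
  (hγ.contDiff_deriv_coord i).continuous

/-- The area formula for the domain bounded by a smooth simple closed curve. -/
theorem abs_integral_eq_two_mul_area (hΩo : IsOpen Ω) (hΩb : Bornology.IsBounded Ω) :
    |∫ t in (0 : ℝ)..(2 * π), (γ t 0 * deriv γ t 1 - γ t 1 * deriv γ t 0)| =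
      2 * volume.real Ω := by
  have h0 := hγ.continuous_coord 0
  have h1 := hγ.continuous_coord 1
  have h0' := hγ.continuous_deriv_coord 0
  have h1' := hγ.continuous_deriv_coord 1
  have hfr : frontier (planeEquivProd '' Ω) = range fun t => planeEquivProd (γ t) := by
    have := planeEquivProd.toHomeomorph.image_frontier Ω
    rw [show (fun t => planeEquivProd (γ t)) = planeEquivProd ∘ γ from rfl, range_comp, hγ.range_eq]
    exact this.symm
  have harea := hγ.isRegularLoop.abs_integral_eq_area (S := planeEquivProd '' Ω)
    (planeEquivProd.toHomeomorph.isOpenMap _ hΩo)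
    (planeEquivProd.lipschitz.isBounded_image hΩb) hfr
  rw [volume_real_image_planeEquivProd] at harea
  have hd : ∀ t, (deriv (fun t => planeEquivProd (γ t)) t).2 = deriv γ t 1 := fun t => by
    have : HasDerivAt (fun t => planeEquivProd (γ t)) (planeEquivProd (deriv γ t)) t :=
      planeEquivProd.toContinuousLinearMap.hasFDerivAt.comp_hasDerivAt t
        (hγ.smooth.differentiable (by simp) t).hasDerivAt
    rw [this.deriv, planeEquivProd_apply]
  simp only [hd] at harea
  simp only [planeEquivProd_apply] at harea
  -- The integral of `d(x₁x₂)` vanishes, so `∫ x₁ dx₂` is half the antisymmetric integral.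
  have hprod : ∫ t in (0 : ℝ)..(2 * π), deriv (fun t => γ t 0 * γ t 1) t = 0 :=
    intervalIntegral_deriv_eq_zero
      (((hγ.contDiff_coord 0).mul (hγ.contDiff_coord 1)).of_le (by simp))
      fun t => by simp only [hγ.periodic t]
  have hdp : ∀ t, deriv (fun t => γ t 0 * γ t 1) t = deriv γ t 0 * γ t 1 + γ t 0 * deriv γ t 1 :=
    fun t => ((hγ.hasDerivAt_coord 0 t).mul (hγ.hasDerivAt_coord 1 t)).deriv
  simp only [hdp] at hprod
  have e : ∀ t, γ t 0 * deriv γ t 1 - γ t 1 * deriv γ t 0 =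
      2 * (γ t 0 * deriv γ t 1) - (deriv γ t 0 * γ t 1 + γ t 0 * deriv γ t 1) := fun t => by ring
  simp only [e]
  rw [intervalIntegral.integral_sub, hprod, sub_zero, intervalIntegral.integral_const_mul, abs_mul,
    harea, abs_of_pos two_pos]
  · exact (continuous_const.mul (h0.mul h1')).intervalIntegrable _ _
  · exact ((h0'.mul h1).add (h0.mul h1')).intervalIntegrable _ _

/-- The potential integrates to `β / 2` times twice the signed area; the absolute value accounts for
the free orientation. -/
theorem abs_circulation (hΩo : IsOpen Ω) (hΩb : Bornology.IsBounded Ω) {β : ℝ} (hβ : 0 < β) :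
    |circulation β γ| = β * volume.real Ω := by
  have e : circulation β γ =
      β / 2 * ∫ t in (0 : ℝ)..(2 * π), (γ t 0 * deriv γ t 1 - γ t 1 * deriv γ t 0) := by
    rw [circulation, ← intervalIntegral.integral_const_mul]
    congr 1; ext t
    rw [standardPotential]; ring
  rw [e, abs_mul, hγ.abs_integral_eq_two_mul_area hΩo hΩb, abs_of_pos (by positivity)]
  ring

theorem isoperimetric (hΩo : IsOpen Ω) (hΩb : Bornology.IsBounded Ω) :
    4 * π * volume.real Ω ≤ curveLength γ ^ 2 ∧
    (4 * π * volume.real Ω = curveLength γ ^ 2 → ∃ m R, ∀ t, ‖γ t - m‖ = R) := by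
  set Φ : Plane ≃ₗᵢ[ℝ] ℂ := Complex.orthonormalBasisOneI.repr.symm
  have hΦa : ∀ x : Plane, Φ x = x 0 + x 1 * Complex.I :=
    Complex.orthonormalBasisOneI_repr_symm_apply
  have hd : ∀ t, deriv (fun t => Φ (γ t)) t = Φ (deriv γ t) := fun t =>
    (Φ.toContinuousLinearEquiv.toContinuousLinearMap.hasFDerivAt.comp_hasDerivAt t
      (hγ.smooth.differentiable (by simp) t).hasDerivAt).deriv
  obtain ⟨h1, h2⟩ := _root_.isoperimetric (g := fun t => Φ (γ t)) (A := volume.real Ω)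
    (L := curveLength γ) ((Φ.contDiff.comp hγ.smooth).of_le (by simp))
    (fun t => by simp only [hγ.periodic t])
    (fun t => by rw [hd]; simpa using hγ.regular t)
    (by
      rw [← hγ.abs_integral_eq_two_mul_area hΩo hΩb]
      congr 2; ext t
      rw [hd, hΦa, hΦa]
      simp only [Complex.mul_im, Complex.conj_re, Complex.conj_im, Complex.add_re, Complex.add_im,
        Complex.ofReal_re, Complex.ofReal_im, Complex.mul_re, Complex.I_re, Complex.I_im]
      ring)
    (by simp only [hd, LinearIsometryEquiv.norm_map]; rfl)
  refine ⟨h1, fun heq => ?_⟩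
  obtain ⟨m, R, hmR⟩ := h2 heq
  refine ⟨Φ.symm m, R, fun t => ?_⟩
  rw [← hmR t, ← Φ.norm_map, map_sub, Φ.apply_symm_apply]

/-- A bounded open set whose boundary curve lies on a circle is a disk. -/
theorem eq_ball_of_norm_sub_eq (hΩo : IsOpen Ω) (hΩb : Bornology.IsBounded Ω) {m : Plane} {R : ℝ}
    (h : ∀ t, ‖γ t - m‖ = R) : 0 < R ∧ Ω = Metric.ball m R := by
  have hfr : frontier Ω ⊆ Metric.sphere m R := by
    rw [← hγ.range_eq]
    rintro _ ⟨t, rfl⟩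
    rw [mem_sphere_iff_norm, h t]
  have hR0 : 0 ≤ R := h 0 ▸ norm_nonneg _
  have hR : 0 < R := by
    refine hR0.lt_of_ne fun h0 => hγ.regular 0 ?_
    have : γ = fun _ => m := funext fun t => sub_eq_zero.1 (norm_eq_zero.1 ((h t).trans h0.symm))
    rw [this, deriv_const]
  have hsub : Ω ⊆ Metric.closedBall m R := by
    intro p hp
    by_contra hpR
    rw [Metric.mem_closedBall, not_le, dist_eq_norm] at hpR
    -- The outward ray from a point beyond the circle avoids the frontier, so it would lie entirely
    -- in the bounded set `Ω`.
    set ray : Set Plane := (fun s : ℝ => m + s • (p - m)) '' Ici 1 with hray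
    have hpre : IsPreconnected ray := isPreconnected_Ici.image _ (by fun_prop)
    have hdis : Disjoint ray (frontier Ω) := by
      rw [disjoint_left]
      rintro _ ⟨s, hs, rfl⟩ hs'
      have := hfr hs'
      rw [mem_sphere_iff_norm, add_sub_cancel_left, norm_smul, Real.norm_eq_abs,
        abs_of_nonneg (zero_le_one.trans hs)] at this
      have hs1 : (1 : ℝ) ≤ s := hs
      nlinarith [norm_nonneg (p - m)]
    have hpray : p ∈ ray := ⟨1, by simp, by simp⟩
    have hrayΩ : ray ⊆ Ω := (hpre.subset_or_disjoint_of_disjoint_frontier hdis).resolve_right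
      fun hd => disjoint_left.1 hd hpray hp
    obtain ⟨C, hC⟩ := (hΩb.subset hrayΩ).subset_closedBall m
    have hmem : m + (|C| / R + 1) • (p - m) ∈ ray := ⟨_, by
      have : 0 ≤ |C| / R := by positivity
      simpa using this, rfl⟩
    have := hC hmem
    rw [Metric.mem_closedBall, dist_eq_norm, add_sub_cancel_left, norm_smul, Real.norm_eq_abs,
      abs_of_nonneg (by positivity)] at this
    have h1 : |C| / R * R = |C| := div_mul_cancel₀ _ hR.ne'
    have h2 : |C| / R * R ≤ |C| / R * ‖p - m‖ := by gcongr
    nlinarith [le_abs_self C]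
  have hball : Ω ⊆ Metric.ball m R := by
    rw [← interior_closedBall m hR.ne']
    exact interior_maximal hsub hΩo
  refine ⟨hR, hball.antisymm ?_⟩
  have hne : Ω.Nonempty := by
    rw [← closure_nonempty_iff]
    exact ⟨γ 0, frontier_subset_closure (hγ.range_eq ▸ mem_range_self 0)⟩
  obtain ⟨p, hp⟩ := hne
  refine ((convex_ball m R).isPreconnected.subset_or_disjoint_of_disjoint_frontier ?_).resolve_right
    fun hd => disjoint_left.1 hd (hball hp) hp
  exact Metric.sphere_disjoint_ball.symm.mono_right hfr

end IsBoundaryCurve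

/-! ### Disks and the explicit first eigenvalue. -/

lemma volume_real_ball_plane (m : Plane) {R : ℝ} (hR : 0 ≤ R) :
    volume.real (Metric.ball m R) = π * R ^ 2 := by
  rw [measureReal_def, EuclideanSpace.volume_ball_fin_two]
  simp [hR, Real.pi_pos.le, mul_comm]

/-- Any regular parametrization of a circle of radius `R` as a simple closed curve has length
`2πR`. -/
theorem IsBoundaryCurve.curveLength_of_ball {γ : ℝ → Plane} {m : Plane} {R : ℝ} (hR : 0 < R)
    (hγ : IsBoundaryCurve γ (Metric.ball m R)) : curveLength γ = 2 * π * R := by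
  have h0 := hγ.continuous_coord 0
  have h1 := hγ.continuous_coord 1
  have h0' := hγ.continuous_deriv_coord 0
  have h1' := hγ.continuous_deriv_coord 1
  have harea := hγ.abs_integral_eq_two_mul_area Metric.isOpen_ball Metric.isBounded_ball
  rw [volume_real_ball_plane m hR.le] at harea
  have hsphere : ∀ t, (γ t 0 - m 0) ^ 2 + (γ t 1 - m 1) ^ 2 = R ^ 2 := fun t => by
    have : γ t ∈ frontier (Metric.ball m R) := hγ.range_eq ▸ mem_range_self t
    rw [frontier_ball m hR.ne', mem_sphere_iff_norm] at this
    rw [← this, EuclideanSpace.norm_sq_eq]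
    simp
  have horth : ∀ t, (γ t 0 - m 0) * deriv γ t 0 + (γ t 1 - m 1) * deriv γ t 1 = 0 := fun t => by
    have hd := (((hγ.hasDerivAt_coord 0 t).sub_const (m 0)).pow 2).add
      (((hγ.hasDerivAt_coord 1 t).sub_const (m 1)).pow 2)
    have hd' := hd.unique (HasDerivAt.congr_of_eventuallyEq (hasDerivAt_const t (R ^ 2))
      (Eventually.of_forall hsphere))
    push_cast at hd'
    linarith
  -- Since `γ - m` is orthogonal to `γ'`, this determinant has modulus `R * ‖γ'‖` and never
  -- vanishes. Its sign is constant, so twice the area is `R` times the length, with no appeal to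
  -- winding numbers.
  set q : ℝ → ℝ := fun t => (γ t 0 - m 0) * deriv γ t 1 - (γ t 1 - m 1) * deriv γ t 0 with hq
  have hqc : Continuous q :=
    ((h0.sub continuous_const).mul h1').sub ((h1.sub continuous_const).mul h0')
  have hqabs : ∀ t, |q t| = R * ‖deriv γ t‖ := fun t => by
    have hn : ‖deriv γ t‖ ^ 2 = deriv γ t 0 ^ 2 + deriv γ t 1 ^ 2 := by
      rw [EuclideanSpace.norm_sq_eq, Fin.sum_univ_two]
      simp only [Real.norm_eq_abs, sq_abs]
    have e : q t ^ 2 = (R * ‖deriv γ t‖) ^ 2 := by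
      rw [mul_pow, hn, ← hsphere t]
      linear_combination (-((γ t 0 - m 0) * deriv γ t 0 + (γ t 1 - m 1) * deriv γ t 1)) * horth t
    rw [← Real.sqrt_sq_eq_abs, e, Real.sqrt_sq (mul_nonneg hR.le (norm_nonneg _))]
  have hq0 : ∀ t, q t ≠ 0 := fun t h => by
    have := hqabs t
    rw [h, abs_zero] at this
    exact (mul_pos hR (hγ.norm_deriv_pos t)).ne this
  have hqint : ∫ t in (0 : ℝ)..(2 * π), q t =
      ∫ t in (0 : ℝ)..(2 * π), (γ t 0 * deriv γ t 1 - γ t 1 * deriv γ t 0) := by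
    have hz : ∀ i, ∫ t in (0 : ℝ)..(2 * π), deriv γ t i = 0 := fun i => by
      have := intervalIntegral_deriv_eq_zero ((hγ.contDiff_coord i).of_le (by simp))
        (T := 2 * π) fun t => by simp only [hγ.periodic t]
      simpa only [(hγ.hasDerivAt_coord i _).deriv] using this
    have e : ∀ t, q t = (γ t 0 * deriv γ t 1 - γ t 1 * deriv γ t 0) -
        (m 0 * deriv γ t 1 - m 1 * deriv γ t 0) := fun t => by simp only [hq]; ring
    simp only [e]
    rw [intervalIntegral.integral_sub, intervalIntegral.integral_sub (f := fun t => m 0 * deriv γ t 1),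
      intervalIntegral.integral_const_mul, intervalIntegral.integral_const_mul, hz, hz]
    · ring
    · exact (continuous_const.mul h1').intervalIntegrable _ _
    · exact (continuous_const.mul h0').intervalIntegrable _ _
    · exact ((h0.mul h1').sub (h1.mul h0')).intervalIntegrable _ _
    · exact ((continuous_const.mul h1').sub (continuous_const.mul h0')).intervalIntegrable _ _
  have hsign : |∫ t in (0 : ℝ)..(2 * π), q t| = ∫ t in (0 : ℝ)..(2 * π), |q t| := by
    have hdich : (∀ t, 0 < q t) ∨ ∀ t, q t < 0 := by
      by_contra hcon
      push Not at hcon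
      obtain ⟨⟨a, ha⟩, b, hb⟩ := hcon
      obtain ⟨t, ht⟩ := mem_range_of_exists_le_of_exists_ge hqc ⟨a, ha⟩ ⟨b, hb⟩
      exact hq0 t ht
    have hπ := two_pi_pos.le
    rcases hdich with h | h
    · rw [abs_of_nonneg (intervalIntegral.integral_nonneg hπ fun t _ => (h t).le)]
      simp only [abs_of_pos (h _)]
    · simp only [abs_of_neg (h _), intervalIntegral.integral_neg]
      rw [abs_of_nonpos]
      rw [← neg_nonneg, ← intervalIntegral.integral_neg]
      exact intervalIntegral.integral_nonneg hπ fun t _ => by linarith [h t]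
  rw [← hqint, hsign] at harea
  simp only [hqabs, intervalIntegral.integral_const_mul] at harea
  change R * curveLength γ = _ at harea
  exact mul_left_cancel₀ hR.ne' (by rw [harea]; ring)

/-- The distance to the integers gives the minimum of the explicit eigenvalues. -/
lemma isLeast_range_mul_sub_sq {a : ℝ} (ha : 0 ≤ a) (x : ℝ) :
    IsLeast (range fun n : ℤ => a * ((n : ℝ) - x) ^ 2) (a * |x - round x| ^ 2) := by
  constructor
  · exact ⟨round x, by rw [sq_abs]; ring⟩
  · rintro _ ⟨n, rfl⟩
    simp only
    rw [← sq_abs ((n : ℝ) - x), abs_sub_comm (n : ℝ) x]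
    have := round_le x n
    gcongr

namespace IsBoundaryCurve

variable {γ : ℝ → Plane} {Ω : Set Plane} (hγ : IsBoundaryCurve γ Ω)

include hγ

theorem curveEigenvalues_eq_range (hΩo : IsOpen Ω) (hΩb : Bornology.IsBounded Ω) {β : ℝ}
    (hβ : 0 < β) : curveEigenvalues β γ = range fun n : ℤ =>
      4 * π ^ 2 / curveLength γ ^ 2 * ((n : ℝ) - β * volume.real Ω / (2 * π)) ^ 2 := by
  have hL := hγ.curveLength_pos.ne'
  have hπ := Real.pi_pos.ne'
  rw [hγ.curveEigenvalues_eq]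
  have habs := hγ.abs_circulation hΩo hΩb hβ
  rcases abs_choice (circulation β γ) with h | h
  · rw [h] at habs
    congr 1; ext n
    rw [habs]; field_simp; ring
  · rw [h] at habs
    rw [← (Equiv.neg ℤ).surjective.range_comp]
    congr 1; ext n
    have e : circulation β γ = -(β * volume.real Ω) := by linarith
    simp only [Function.comp_apply, Equiv.neg_apply, e]
    push_cast; field_simp; ring

theorem curveLambda1_eq (hΩo : IsOpen Ω) (hΩb : Bornology.IsBounded Ω) {β : ℝ} (hβ : 0 < β) :
    curveLambda1 β γ = 4 * π ^ 2 / curveLength γ ^ 2 *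
      |β * volume.real Ω / (2 * π) - round (β * volume.real Ω / (2 * π))| ^ 2 := by
  rw [curveLambda1, hγ.curveEigenvalues_eq_range hΩo hΩb hβ]
  exact (isLeast_range_mul_sub_sq (by positivity) _).csInf_eq

lemma volume_real_pos (hΩo : IsOpen Ω) (hΩb : Bornology.IsBounded Ω) : 0 < volume.real Ω := by
  have hne : Ω.Nonempty := by
    rw [← closure_nonempty_iff]
    exact ⟨γ 0, frontier_subset_closure (hγ.range_eq ▸ mem_range_self 0)⟩
  exact ENNReal.toReal_pos (hΩo.measure_pos volume hne).ne' hΩb.measure_lt_top.ne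

end IsBoundaryCurve

/-- Equality in the isoperimetric inequality characterizes disks. -/
theorem IsBoundaryCurve.eq_ball_of_isoperimetric_eq {γ : ℝ → Plane} {Ω : Set Plane}
    (hγ : IsBoundaryCurve γ Ω) (hΩo : IsOpen Ω) (hΩb : Bornology.IsBounded Ω) {R : ℝ} (hR : 0 < R)
    (harea : volume.real Ω = π * R ^ 2) (h : 4 * π * volume.real Ω = curveLength γ ^ 2) :
    ∃ c, Ω = Metric.ball c R := by
  obtain ⟨m, R', hmR⟩ := (hγ.isoperimetric hΩo hΩb).2 h
  obtain ⟨hR', hball⟩ := hγ.eq_ball_of_norm_sub_eq hΩo hΩb hmR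
  have e : R' = R := by
    rw [hball, volume_real_ball_plane m hR'.le] at harea
    exact (pow_left_inj₀ hR'.le hR.le two_ne_zero).1 (mul_left_cancel₀ Real.pi_pos.ne' harea)
  exact ⟨m, e ▸ hball⟩

/-! ### The main theorem. -/

theorem mainTheorem8 (β : ℝ) (hβ : 0 < β) (Ω : Set Plane) (γ : ℝ → Plane)
    (hΩ : IsSmoothSimplyConnectedDomain Ω γ) :
    -- there is a first eigenvalue, and it is given by the explicit formula
    IsLeast (curveEigenvalues β γ) (curveLambda1 β γ) ∧
    IsLeast (range fun n : ℤ =>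
        4 * π ^ 2 / curveLength γ ^ 2 * ((n : ℝ) - β * volume.real Ω / (2 * π)) ^ 2)
      (curveLambda1 β γ) ∧
    -- comparison with the circle bounding a disk of the same area
    (∀ (c : Plane) (R : ℝ) (γs : ℝ → Plane), 0 < R →
      IsBoundaryCurve γs (Metric.ball c R) →
      volume Ω = volume (Metric.ball c R) →
      curveLambda1 β γ ≤ curveLambda1 β γs ∧
      ((∀ n : ℕ, β * volume.real Ω / (2 * π) ≠ n) →
        (curveLambda1 β γ = curveLambda1 β γs ↔ ∃ c' : Plane, Ω = Metric.ball c' R))) ∧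
    -- the universal bound
    curveLambda1 β γ ≤ β / 4 ∧
    (curveLambda1 β γ = β / 4 ↔ ∃ c' : Plane, Ω = Metric.ball c' (1 / √β)) := by
  have hγ := hΩ.boundary
  have hπ := Real.pi_pos
  have hleast : IsLeast (range fun n : ℤ =>
        4 * π ^ 2 / curveLength γ ^ 2 * ((n : ℝ) - β * volume.real Ω / (2 * π)) ^ 2)
      (curveLambda1 β γ) := by
    rw [hγ.curveLambda1_eq hΩ.isOpen hΩ.bounded hβ]
    exact isLeast_range_mul_sub_sq (by positivity) _
  have hlam := hγ.curveLambda1_eq hΩ.isOpen hΩ.bounded hβ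
  have hA := hγ.volume_real_pos hΩ.isOpen hΩ.bounded
  have hiso := (hγ.isoperimetric hΩ.isOpen hΩ.bounded).1
  have hL := hγ.curveLength_pos
  have hball := fun R hR => hγ.eq_ball_of_isoperimetric_eq hΩ.isOpen hΩ.bounded (R := R) hR
  refine ⟨?_, hleast, ?_, ?_⟩
  · rw [hγ.curveEigenvalues_eq_range hΩ.isOpen hΩ.bounded hβ]
    exact hleast
  · intro c R γs hR hγs hvol
    have hvol' : volume.real Ω = volume.real (Metric.ball c R) := by
      rw [measureReal_def, hvol, measureReal_def]
    have hlams := hγs.curveLambda1_eq Metric.isOpen_ball Metric.isBounded_ball hβ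
    rw [← hvol', hγs.curveLength_of_ball hR] at hlams
    rw [volume_real_ball_plane c hR.le] at hvol'
    set x := β * volume.real Ω / (2 * π) with hx
    have hle : (2 * π * R) ^ 2 ≤ curveLength γ ^ 2 := by
      rw [hvol'] at hiso; nlinarith
    refine ⟨?_, fun hnat => ⟨fun heq => ?_, ?_⟩⟩
    · rw [hlam, hlams]
      gcongr
    · have hx0 : 0 ≤ x := by positivity
      -- Excluding natural numbers excludes all integers, because `x` is nonnegative.
      have hd : |x - round x| ^ 2 ≠ 0 := by
        intro h0
        have h1 : x = round x := sub_eq_zero.1 (abs_eq_zero.1 (pow_eq_zero_iff two_ne_zero |>.1 h0))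
        have h2 : 0 ≤ round x := by
          have : (0 : ℝ) ≤ round x := h1 ▸ hx0
          exact_mod_cast this
        obtain ⟨n, hn⟩ := Int.eq_ofNat_of_zero_le h2
        exact hnat n (by rw [h1, hn]; simp)
      rw [hlam, hlams] at heq
      have h3 := mul_right_cancel₀ hd heq
      rw [div_eq_div_iff (by positivity) (by positivity)] at h3
      have h4 : curveLength γ ^ 2 = (2 * π * R) ^ 2 :=
        (mul_left_cancel₀ (by positivity) h3).symm
      exact hball R hR hvol' (by rw [h4, hvol']; ring)
    · rintro ⟨c', rfl⟩
      rw [hlam, hlams, hγ.curveLength_of_ball hR]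
  · have harea : volume.real Ω = π * (1 / √β) ^ 2 ↔ β * volume.real Ω / (2 * π) = 1 / 2 := by
      rw [div_pow, one_pow, Real.sq_sqrt hβ.le, mul_one_div, eq_div_iff hβ.ne',
        div_eq_iff (by positivity)]
      constructor <;> intro h <;> linarith
    have hsβ : 0 < 1 / √β := by positivity
    set x := β * volume.real Ω / (2 * π) with hx
    have hx0 : 0 < x := by positivity
    set d := |x - round x| with hd
    have hd0 : 0 ≤ d := abs_nonneg _
    have hd1 : d ≤ 1 / 2 := abs_sub_round x
    have hd2 : d ≤ x := by
      have := round_le x 0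
      rwa [Int.cast_zero, sub_zero, abs_of_pos hx0] at this
    -- One factor `d` is bounded by `1 / 2`, the other by `x`, its distance to the integer `0`.
    have hdx : d ^ 2 ≤ x / 2 := by nlinarith
    have hAx : 4 * π * volume.real Ω = 8 * π ^ 2 * x / β := by rw [hx]; field_simp; ring
    have hLx : 8 * π ^ 2 * x ≤ β * curveLength γ ^ 2 := by
      rw [hAx, div_le_iff₀ hβ] at hiso; linarith
    have hlam' : curveLambda1 β γ = 4 * π ^ 2 * d ^ 2 / curveLength γ ^ 2 := by rw [hlam]; ring
    have hπd : 8 * π ^ 2 * (2 * d ^ 2) ≤ 8 * π ^ 2 * x := by gcongr; linarith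
    refine ⟨?_, fun heq => ?_, ?_⟩
    · rw [hlam', div_le_iff₀ (by positivity)]
      nlinarith
    · rw [hlam', div_eq_iff (by positivity)] at heq
      -- Equality collapses the chain `16π²d² ≤ 8π²x ≤ βL²`. Then `2d² = x ≥ d` with `0 < d ≤ 1/2`
      -- leaves only `d = x = 1/2`, and the second link becomes isoperimetric equality.
      have h1 : 8 * π ^ 2 * (2 * d ^ 2) = 8 * π ^ 2 * x := by linarith
      have h2 : 2 * d ^ 2 = x := mul_left_cancel₀ (by positivity) h1
      have h3 : d ≠ 0 := by rintro h0; rw [h0] at h2; simp at h2; linarith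
      have h4 : d = 1 / 2 := by
        have : 0 < d := hd0.lt_of_ne h3.symm
        nlinarith
      have h5 : x = 1 / 2 := by rw [← h2, h4]; norm_num
      refine hball _ hsβ (harea.2 h5) ?_
      rw [hAx, div_eq_iff hβ.ne']; linarith
    · rintro ⟨c', rfl⟩
      have h1 : x = 1 / 2 := harea.1 (volume_real_ball_plane c' hsβ.le)
      have h2 : d = 1 / 2 := by
        rw [hd, h1]; norm_num [round_eq]
      rw [hlam', h2, hγ.curveLength_of_ball hsβ, mul_pow, div_pow _ (√β),
        Real.sq_sqrt hβ.le]
      field_simp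
      norm_num
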